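/- **Proposition 3.5.** Let $\mathcal A$ be a finite alphabet, and let $\mathbb P,\mathbb Q$ be probability measures on $\mathcal A^{\mathbb N}$ (sequences $x=(x_k)_{k\ge1}$) that are invariant under the left shift $T$. Write $x_m^n=x_m x_{m+1}\cdots x_n$, let $\mathbb P[a]$ be the probability that a sequence starts with the word $a$ (so $\mathbb P[\text{empty word}]=1$), and put $\operatorname{supp}\mathbb P_n=\{a\in\mathcal A^n:\mathbb P[a]>0\}$ and $\operatorname{supp}\mathbb P=\{x:\mathbb P[x_1^n]>0\text{ for all }n\}$; similarly for $\mathbb Q$. Let $$\bar q(\alpha)=\limsup_{n\to\infty}\frac1n\ln\sum_{a\in\operatorname{supp}\mathbb P_n}\mathbb P[a]^{-\alpha}\,\mathbb Q[a]\in[-\infty,\infty],\qquad\alpha\in\mathbb R.$$ Assume that $\operatorname{supp}\mathbb Q\subseteq\operatorname{supp}\mathbb P$ and that the following hold. - (SLD for $\mathbb P$) There are sequences $k_n\in[0,\infty)$ and $\tau_n\in\{0,1,2,\dots\}$, both $o(n)$, such that for all $n,m\ge1$, $a\in\operatorname{supp}\mathbb P_n$ and $b\in\operatorname{supp}\mathbb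 P_m$ there are $0\le\ell\le\tau_n$ and $\xi\in\operatorname{supp}\mathbb P_\ell$ with $\mathbb P[a\xi b]\ge e^{-k_n}\mathbb P[a]\mathbb P[b]$. - (SE for $\mathbb P$) There are $\beta\ge1$ and $\gamma_-<0$ such that $\mathbb P[a]\ge e^{\gamma_- n^\beta}$ for all $n\ge1$ and $a\in\operatorname{supp}\mathbb P_n$. - (UD for $\mathbb Q$) There are sequences $k_n\in[0,\infty)$ and $\tau_n\in\{0,1,2,\dots\}$, both $o(n)$, such that $\mathbb Q[a\xi b]\le e^{k_n}\mathbb Q[a]\mathbb Q[b]$ for all $n,m\ge1$, $a\in\operatorname{supp}\mathbb Q_n$, $\xi\in\operatorname{supp}\mathbb Q_{\tau_n}$ and $b\in\operatorname{supp}\mathbb Q_m$. - (ND) $\bar q(-1)<0$. For sequences $x,y$ and $N,\ell\ge1$ let $W_\ell(y,x)=\inf\{r\ge1:x_r^{r+\ell-1}=y_1^\ell\}$ (with $\inf\emptyset=\infty$) and $\Lambda_N(y,x)=\max\{1,\sup\{\ell\ge1:W_\ell(y,x)\le N-\ell+1\}\}$ (the supremum being omitted if the set is empty). Parse $y_1^N$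 with respect to $x_1^N$ as follows: $L_0=0$, and as long as $L_i<N$, put $L_{i+1}=\min\{N,\,L_i+\Lambda_N(T^{L_i}y,x)+1\}$ and $\overline w^{(i+1,N)}=y_{L_i+1}^{L_{i+1}}$. Let $c_N=c_N(y|x)$ be the number of words obtained, and let $\underline w^{(i,N)}$ be $\overline w^{(i,N)}$ without its last letter. Then the one-sided derivatives $D_-\bar q(0)$ and $D_+\bar q(0)$ exist in $[-\infty,\infty]$ and, for $(\mathbb P\otimes\mathbb Q)$-almost every $(x,y)$, $$\liminf_{N\to\infty}\frac1{N-c_N}\sum_{i=1}^{c_N}-\ln\mathbb P[\underline w^{(i,N)}]\ \ge\ D_-\bar q(0) \qquad\text{and}\qquad \limsup_{N\to\infty}\frac1N\sum_{i=1}^{c_N-1}-\ln\mathbb P[\overline w^{(i,N)}]\ \le\ D_+\bar q(0).$$ -/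

import Mathlib

open MeasureTheory Filter Topology Asymptotics

namespace ZivMerhav

noncomputable section

/-! Sequences `x₁ x₂ x₃ …` over the alphabet `A` are functions `x : ℕ → A`, with `x k` standing
for the letter `x_{k+1}`. Finite words are lists of letters. -/

/-- The left shift `T`. -/
def shift {A : Type*} (x : ℕ → A) : ℕ → A := fun k => x (k + 1)

/-- The word of length `l` read in `x` after skipping the first `s` letters, `x_{s+1}^{s+l}`. -/
def word {A : Type*} (x : ℕ → A) (s l : ℕ) : List A := (List.range l).map fun i => x (s + i)

/-- The basic cylinder `[a]`. -/
def wordCylinder {A : Type*} (a : List A) : Set (ℕ → A) := {x | word x 0 a.length = a}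

/-- The probability `μ[a]` of the cylinder of `a`. It is `1` for the empty word when `μ` is a
probability measure. -/
def cylProb {A : Type*} [MeasurableSpace A] (μ : Measure (ℕ → A)) (a : List A) : ℝ :=
  μ.real (wordCylinder a)

/-- `supp μ_n`: the words of length `n` with positive probability. -/
def wordSupport {A : Type*} [MeasurableSpace A] (μ : Measure (ℕ → A)) (n : ℕ) : Set (List A) :=
  {a | a.length = n ∧ 0 < cylProb μ a}

/-- `supp μ`: the sequences all of whose prefixes have positive probability. -/
def seqSupport {A : Type*} [MeasurableSpace A] (μ : Measure (ℕ → A)) : Set (ℕ → A) :=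
  {x | ∀ n : ℕ, 0 < cylProb μ (word x 0 n)}

/-- A pair of `o(n)`-sequences, one with values in `[0, ∞)` and one with values in `ℕ₀`. -/
def SublinearPair (k : ℕ → ℝ) (τ : ℕ → ℕ) : Prop :=
  (∀ n, 0 ≤ k n) ∧ (k =o[atTop] fun n : ℕ => (n : ℝ)) ∧
    ((fun n => (τ n : ℝ)) =o[atTop] fun n : ℕ => (n : ℝ))

/-- Upper decoupling (UD). -/
def UpperDecoupled {A : Type*} [MeasurableSpace A] (μ : Measure (ℕ → A)) : Prop :=
  ∃ (k : ℕ → ℝ) (τ : ℕ → ℕ), SublinearPair k τ ∧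
    ∀ n : ℕ, 1 ≤ n → ∀ a ∈ wordSupport μ n, ∀ ξ ∈ wordSupport μ (τ n),
      ∀ m : ℕ, 1 ≤ m → ∀ b ∈ wordSupport μ m,
        cylProb μ (a ++ ξ ++ b) ≤ Real.exp (k n) * (cylProb μ a * cylProb μ b)

/-- Selective lower decoupling (SLD). -/
def SelectivelyLowerDecoupled {A : Type*} [MeasurableSpace A] (μ : Measure (ℕ → A)) : Prop :=
  ∃ (k : ℕ → ℝ) (τ : ℕ → ℕ), SublinearPair k τ ∧
    ∀ n : ℕ, 1 ≤ n → ∀ a ∈ wordSupport μ n, ∀ m : ℕ, 1 ≤ m → ∀ b ∈ wordSupport μ m,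
      ∃ l : ℕ, l ≤ τ n ∧ ∃ ξ ∈ wordSupport μ l,
        Real.exp (-k n) * (cylProb μ a * cylProb μ b) ≤ cylProb μ (a ++ ξ ++ b)

/-- Slow enough decay (SE). -/
def DecaysSlowlyEnough {A : Type*} [MeasurableSpace A] (μ : Measure (ℕ → A)) : Prop :=
  ∃ (β γ : ℝ), 1 ≤ β ∧ γ < 0 ∧
    ∀ n : ℕ, 1 ≤ n → ∀ a ∈ wordSupport μ n, Real.exp (γ * (n : ℝ) ^ β) ≤ cylProb μ a

/-- The sum of `P[a]^{-α} Q[a]` over the words `a` of length `n` with `P[a] > 0`. It is positive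
as soon as the support of `Q` is contained in that of `P`. -/
def pressureSum {A : Type*} [Fintype A] [MeasurableSpace A] (P Q : Measure (ℕ → A))
    (α : ℝ) (n : ℕ) : ℝ :=
  ∑ v : Fin n → A with 0 < cylProb P (List.ofFn v),
    cylProb P (List.ofFn v) ^ (-α) * cylProb Q (List.ofFn v)

/-- The cross-entropic pressure, with values in `[-∞, ∞]`. -/
def pressure {A : Type*} [Fintype A] [MeasurableSpace A] (P Q : Measure (ℕ → A))
    (α : ℝ) : EReal :=
  limsup (fun n : ℕ => ((1 / (n : ℝ) * Real.log (pressureSum P Q α n) : ℝ) : EReal)) atTop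

/-- Nondegeneracy (ND). -/
def Nondegenerate {A : Type*} [Fintype A] [MeasurableSpace A] (P Q : Measure (ℕ → A)) : Prop :=
  pressure P Q (-1) < 0

/-- The left derivative of `f` at `t` exists in `[-∞, ∞]` and equals `D`
(meant for functions that are finite at `t`). -/
def HasLeftDeriv (f : ℝ → EReal) (t : ℝ) (D : EReal) : Prop :=
  Tendsto (fun α : ℝ => (f α - f t) / ((α - t : ℝ) : EReal)) (𝓝[<] t) (𝓝 D)

/-- The right derivative of `f` at `t` exists in `[-∞, ∞]` and equals `D`
(meant for functions that are finite at `t`). -/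
def HasRightDeriv (f : ℝ → EReal) (t : ℝ) (D : EReal) : Prop :=
  Tendsto (fun α : ℝ => (f α - f t) / ((α - t : ℝ) : EReal)) (𝓝[>] t) (𝓝 D)

/-- The waiting time `W_l(y, x) = inf {r ≥ 1 : x_r^{r+l-1} = y_1^l}`, with `inf ∅ = ∞`. -/
def waitingTime {A : Type*} (l : ℕ) (y x : ℕ → A) : ℕ∞ :=
  sInf {w : ℕ∞ | ∃ r : ℕ, 1 ≤ r ∧ word x (r - 1) l = word y 0 l ∧ w = (r : ℕ∞)}

/-- The match length `Λ_N(y, x) = max {1, sup {l ≥ 1 : W_l(y, x) ≤ N - l + 1}}`. The inequality is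
written without subtraction; since waiting times are at least `1`, it forces `l ≤ N`. -/
def matchLength {A : Type*} (N : ℕ) (y x : ℕ → A) : ℕ :=
  max 1 (sSup {l : ℕ | 1 ≤ l ∧ waitingTime l y x + (l : ℕ∞) ≤ (N : ℕ∞) + 1})

/-- The total length `L_{i,N}` of the first `i` words of the modified Ziv–Merhav parsing of `y_1^N`
with respect to `x_1^N`. Once it reaches `N`, the procedure is over and the value stays at `N`. -/
def parseEnd {A : Type*} (N : ℕ) (y x : ℕ → A) : ℕ → ℕ
  | 0 => 0
  | i + 1 => min N (parseEnd N y x i + matchLength N (shift^[parseEnd N y x i] y) x + 1)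

/-- The number `c_N(y|x)` of words in the parsing. -/
def parseCount {A : Type*} (N : ℕ) (y x : ℕ → A) : ℕ := sInf {i : ℕ | parseEnd N y x i = N}

/-- The word with number `i + 1` of the parsing, for `i < c_N(y|x)`. -/
def parsedWord {A : Type*} (N : ℕ) (y x : ℕ → A) (i : ℕ) : List A :=
  word y (parseEnd N y x i) (parseEnd N y x (i + 1) - parseEnd N y x i)

/-- The word with number `i + 1` of the parsing, without its last letter. -/
def trimmedWord {A : Type*} (N : ℕ) (y x : ℕ → A) (i : ℕ) : List A :=
  (parsedWord N y x i).dropLast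

end

end ZivMerhav

set_option linter.unusedSectionVars false

/-! Write q for `pressure P Q`. Jensen's inequality with the weights Q[a] gives q(θα) ≤ θ q(α) for 0
< θ ≤ 1, and q(0) = 0. So the slopes q(α)/α are monotone on each side of 0, and their supremum over
α < 0 and infimum over α > 0 are the one-sided derivatives. A number R below the left (above the
right) derivative comes with some α < 0 (α > 0) such that the Q-expectation of P[y_1^n]^{-α} is at
most e^{αRn} for large n.

The core is to pass from this moment bound for one word to all the words of a parsing at once,
although the parsing depends on x and y in an uncontrolled way. `gapSum` adds up the products of
weights over all families of long subwords separated by gaps. Upper decoupling makes its expectation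
grow at an arbitrarily small exponential rate, Borel–Cantelli makes this almost sure, and each
family is dominated by the whole sum. The resulting bound `UpperDecoupled.ae_eventually_sum_log_le`
is uniform over families and has an exceptional set in y only.

For the lower bound, the gaps are cut from the ends of the words themselves, which can only decrease
-ln P. By selective lower decoupling every fixed word of positive probability occurs in x, so all
the words but the last are long and little is lost.

For the upper bound, cutting is not allowed, so the gap after a word is the next word, and even and
odd indices are treated separately. This fails when the next word is too short. A complete word does
not occur in x_1^N, while short words that are not too improbable do, so each such failure (but one)
marks a start of an improbable short word in y, and a moment bound makes these rare. Nondegeneracy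
limits complete words to logarithmic length, hence each failure costs only O(ln N). -/

namespace ZivMerhav

/-! ### Words, subwords and cylinders -/

section Words

variable {A : Type*}

@[simp] lemma length_word (x : ℕ → A) (s l : ℕ) : (word x s l).length = l := by simp [word]

@[simp] lemma shift_iterate_apply (x : ℕ → A) (p k : ℕ) : shift^[p] x k = x (p + k) := by
  induction p generalizing x with
  | zero => simp
  | succ p ih => rw [Function.iterate_succ_apply, ih]; simp [shift]; congr 1; omega

lemma word_shift_iterate (x : ℕ → A) (p s l : ℕ) : word (shift^[p] x) s l = word x (p + s) l := by
  simp [word, Nat.add_assoc]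

lemma word_eq_word_iff {x y : ℕ → A} {s t l : ℕ} :
    word x s l = word y t l ↔ ∀ i < l, x (s + i) = y (t + i) := by
  simp [word]

lemma word_eq_ofFn (x : ℕ → A) (s l : ℕ) : word x s l = List.ofFn (fun i : Fin l => x (s + i)) := by
  apply List.ext_getElem <;> simp [word]

lemma word_eq_ofFn_iff {x : ℕ → A} {s l : ℕ} {v : Fin l → A} :
    word x s l = List.ofFn v ↔ (fun i : Fin l => x (s + i)) = v := by
  rw [word_eq_ofFn, List.ofFn_inj]

lemma word_add (x : ℕ → A) (s a b : ℕ) : word x s (a + b) = word x s a ++ word x (s + a) b := by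
  simp [word, List.range_add, Nat.add_assoc]

lemma dropLast_word (x : ℕ → A) (s l : ℕ) : (word x s l).dropLast = word x s (l - 1) := by
  cases l with
  | zero => simp [word]
  | succ l => rw [word_add]; simp [word]

lemma mem_wordCylinder_iff {a : List A} {x : ℕ → A} : x ∈ wordCylinder a ↔ word x 0 a.length = a :=
  Iff.rfl

lemma word_eq_append_iff {x : ℕ → A} {s : ℕ} {a b : List A} :
    word x s (a ++ b).length = a ++ b ↔
      word x s a.length = a ∧ word x (s + a.length) b.length = b := by
  rw [List.length_append, word_add]
  constructor
  · intro h
    exact List.append_inj h (by simp)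
  · rintro ⟨h1, h2⟩
    rw [h1, h2]

lemma shift_iterate_mem_wordCylinder {a : List A} {x : ℕ → A} {s : ℕ} :
    shift^[s] x ∈ wordCylinder a ↔ word x s a.length = a := by
  rw [mem_wordCylinder_iff, word_shift_iterate, Nat.add_zero]

/-- A sequence that starts with the given finite word. -/
noncomputable def extend [Nonempty A] {n : ℕ} (v : Fin n → A) : ℕ → A :=
  fun i => if h : i < n then v ⟨i, h⟩ else Classical.arbitrary A

lemma extend_apply [Nonempty A] {n : ℕ} (v : Fin n → A) {i : ℕ} (h : i < n) :
    extend v i = v ⟨i, h⟩ := by simp [extend, h]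

end Words

/-! ### Measurability of functions of finitely many letters -/

section Measurability

variable {A : Type*} [Fintype A] [MeasurableSpace A] [MeasurableSingletonClass A]

lemma measurable_window (s l : ℕ) : Measurable fun (y : ℕ → A) (i : Fin l) => y (s + i) :=
  measurable_pi_lambda _ fun i => measurable_pi_apply (s + i : ℕ)

lemma measurable_shift : Measurable (shift : (ℕ → A) → ℕ → A) :=
  measurable_pi_lambda _ fun i => measurable_pi_apply (i + 1)

/-- Such a function factors through the first `M` letters, which take values in a finite discrete
space. -/
lemma measurable_of_local {β : Type*} [MeasurableSpace β] {G : (ℕ → A) → β} (M : ℕ)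
    (h : ∀ y y' : ℕ → A, (∀ i < M, y i = y' i) → G y = G y') : Measurable G := by
  rcases isEmpty_or_nonempty A with hA | hA
  · exact measurable_of_empty _
  · have : G = (fun v : Fin M → A => G (extend v)) ∘ fun y i => y (0 + i) := by
      funext y
      apply h
      intro i hi
      simp [extend_apply _ hi]
    rw [this]
    exact (Measurable.of_discrete).comp (measurable_window 0 M)

lemma measurableSet_of_local {S : Set (ℕ → A)} (M : ℕ)
    (h : ∀ y y' : ℕ → A, (∀ i < M, y i = y' i) → (y ∈ S ↔ y' ∈ S)) : MeasurableSet S :=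
  measurableSet_setOfPred.2 (measurable_of_local (G := fun y => y ∈ S) M fun y y' hy => propext (h y y' hy))

lemma measurable_word_comp {β : Type*} [MeasurableSpace β] (F : List A → β) (s l : ℕ) :
    Measurable fun y : ℕ → A => F (word y s l) :=
  measurable_of_local (s + l) fun y y' h => by
    rw [word_eq_word_iff.2 fun i hi => h (s + i) (by omega)]

lemma measurableSet_word_eq (s l : ℕ) (a : List A) : MeasurableSet {y : ℕ → A | word y s l = a} :=
  measurableSet_setOfPred.2 (measurable_word_comp (fun b => b = a) s l)

lemma measurableSet_wordCylinder (a : List A) : MeasurableSet (wordCylinder a) :=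
  measurableSet_word_eq 0 a.length a

end Measurability

/-! ### Cylinder probabilities of shift-invariant measures -/

section Cylinders

variable {A : Type*} [MeasurableSpace A]
variable (μ : Measure (ℕ → A)) [IsProbabilityMeasure μ]

lemma cylProb_nonneg (a : List A) : 0 ≤ cylProb μ a := measureReal_nonneg

lemma cylProb_le_one (a : List A) : cylProb μ a ≤ 1 := measureReal_le_one

lemma ofReal_cylProb (a : List A) : ENNReal.ofReal (cylProb μ a) = μ (wordCylinder a) :=
  ofReal_measureReal

lemma cylProb_append_le_left (a b : List A) : cylProb μ (a ++ b) ≤ cylProb μ a :=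
  measureReal_mono fun _ hx => (word_eq_append_iff.1 hx).1

lemma cylProb_word_anti (x : ℕ → A) (s : ℕ) {l l' : ℕ} (h : l ≤ l') :
    cylProb μ (word x s l') ≤ cylProb μ (word x s l) := by
  obtain ⟨d, rfl⟩ := Nat.exists_eq_add_of_le h
  rw [word_add]
  exact cylProb_append_le_left μ _ _

variable [Fintype A] [MeasurableSingletonClass A] {μ}

lemma measure_word_eq (hμ : MeasurePreserving shift μ μ) (s : ℕ) (a : List A) :
    μ {y | word y s a.length = a} = μ (wordCylinder a) := by
  rw [← (hμ.iterate s).measure_preimage (measurableSet_wordCylinder a).nullMeasurableSet]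
  congr 1
  ext y
  exact shift_iterate_mem_wordCylinder.symm

lemma cylProb_append_le_right (hμ : MeasurePreserving shift μ μ) (a b : List A) :
    cylProb μ (a ++ b) ≤ cylProb μ b := by
  have : cylProb μ b = μ.real {y | word y a.length b.length = b} := by
    rw [cylProb, measureReal_def, measureReal_def, measure_word_eq hμ]
  rw [this]
  refine measureReal_mono fun x hx => ?_
  simpa using (word_eq_append_iff.1 hx).2

lemma lintegral_word (hμ : MeasurePreserving shift μ μ) (F : List A → ENNReal) (s l : ℕ) :
    ∫⁻ y, F (word y s l) ∂μ = ∑ v : Fin l → A, F (List.ofFn v) * μ (wordCylinder (List.ofFn v)) := by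
  have h : ∀ y : ℕ → A, F (word y s l) = (fun v : Fin l → A => F (List.ofFn v))
      (fun i : Fin l => y (s + i)) := fun y => by rw [word_eq_ofFn]
  simp_rw [h]
  rw [← lintegral_map (f := fun v : Fin l → A => F (List.ofFn v)) Measurable.of_discrete
    (measurable_window s l), lintegral_fintype]
  refine Finset.sum_congr rfl fun v _ => ?_
  rw [Measure.map_apply (measurable_window s l) (measurableSet_singleton v),
    ← measure_word_eq hμ s]
  congr 2
  ext y
  simp only [Set.mem_preimage, Set.mem_singleton_iff, Set.mem_ofPred_eq, List.length_ofFn]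
  exact word_eq_ofFn_iff.symm

lemma sum_cylProb (hμ : MeasurePreserving shift μ μ) (l : ℕ) :
    ∑ v : Fin l → A, cylProb μ (List.ofFn v) = 1 := by
  have h := lintegral_word hμ (fun _ => 1) 0 l
  simp only [lintegral_const, measure_univ, mul_one, one_mul] at h
  rw [← ENNReal.ofReal_eq_ofReal_iff (Finset.sum_nonneg fun v _ => cylProb_nonneg μ _) zero_le_one,
    ENNReal.ofReal_sum_of_nonneg fun v _ => cylProb_nonneg μ _, ENNReal.ofReal_one, h]
  exact Finset.sum_congr rfl fun v _ => ofReal_cylProb μ _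

lemma ae_cylProb_word_pos (hμ : MeasurePreserving shift μ μ) :
    ∀ᵐ y ∂μ, ∀ s l, 0 < cylProb μ (word y s l) := by
  simp only [ae_all_iff]
  intro s l
  have h := lintegral_word hμ (fun a => if 0 < cylProb μ a then 0 else 1) s l
  have h0 : ∑ v : Fin l → A, (if 0 < cylProb μ (List.ofFn v) then 0 else 1 : ENNReal) *
      μ (wordCylinder (List.ofFn v)) = 0 := by
    refine Finset.sum_eq_zero fun v _ => ?_
    split_ifs with hv
    · simp
    · rw [← ofReal_cylProb, ENNReal.ofReal_eq_zero.2 (not_lt.1 hv), mul_zero]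
  rw [h0, lintegral_eq_zero_iff
    (measurable_word_comp (fun a => if 0 < cylProb μ a then (0 : ENNReal) else 1) s l)] at h
  filter_upwards [h] with y hy
  by_contra hc
  simp [hc] at hy

variable {P Q : Measure (ℕ → A)} [IsProbabilityMeasure P] [IsProbabilityMeasure Q]

/-- Almost every `y` lies in the support of `Q`, hence in that of `P`. This makes its prefixes
positive for `P`, and invariance of `P` extends this to subwords that start anywhere. -/
lemma ae_cylProb_word_pos_of_subset (hP : MeasurePreserving shift P P)
    (hQ : MeasurePreserving shift Q Q) (hsupp : seqSupport Q ⊆ seqSupport P) :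
    ∀ᵐ y ∂Q, ∀ s l, 0 < cylProb P (word y s l) := by
  filter_upwards [ae_cylProb_word_pos hQ] with y hy s l
  have hyP : y ∈ seqSupport P := hsupp fun n => hy 0 n
  have h := hyP (s + l)
  rw [word_add, Nat.zero_add] at h
  exact h.trans_le (cylProb_append_le_right hP _ _)

lemma cylProb_pos_of_subset (hP : MeasurePreserving shift P P)
    (hQ : MeasurePreserving shift Q Q) (hsupp : seqSupport Q ⊆ seqSupport P) {a : List A}
    (ha : 0 < cylProb Q a) : 0 < cylProb P a := by
  by_contra hc
  have h : Q (wordCylinder a) = 0 := by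
    refine measure_mono_null ?_ (ae_iff.1 (ae_cylProb_word_pos_of_subset hP hQ hsupp))
    intro y hy hpos
    have := hpos 0 a.length
    rw [mem_wordCylinder_iff.1 hy] at this
    exact hc this
  rw [cylProb, measureReal_def, h] at ha
  simp at ha

end Cylinders

/-! ### The cross-entropic pressure and its slopes at zero -/

section Pressure

variable {A : Type*} [Fintype A] [MeasurableSpace A] [MeasurableSingletonClass A]
variable {P Q : Measure (ℕ → A)} [IsProbabilityMeasure P] [IsProbabilityMeasure Q]

lemma sum_cylProb_support (hP : MeasurePreserving shift P P) (hQ : MeasurePreserving shift Q Q)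
    (hsupp : seqSupport Q ⊆ seqSupport P) (n : ℕ) :
    ∑ v : Fin n → A with 0 < cylProb P (List.ofFn v), cylProb Q (List.ofFn v) = 1 := by
  rw [← sum_cylProb hQ n, Finset.sum_filter]
  refine Finset.sum_congr rfl fun v _ => ?_
  split_ifs with h
  · rfl
  · by_contra hne
    exact h (cylProb_pos_of_subset hP hQ hsupp ((cylProb_nonneg Q _).lt_of_ne hne))

lemma pressureSum_pos (hP : MeasurePreserving shift P P) (hQ : MeasurePreserving shift Q Q)
    (hsupp : seqSupport Q ⊆ seqSupport P) (α : ℝ) (n : ℕ) : 0 < pressureSum P Q α n := by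
  have h := sum_cylProb_support hP hQ hsupp n
  obtain ⟨v, hv, hpos⟩ := Finset.exists_lt_of_sum_lt (s := Finset.univ.filter
    fun v : Fin n → A => 0 < cylProb P (List.ofFn v)) (f := fun _ => (0 : ℝ))
    (g := fun v => cylProb Q (List.ofFn v)) (by simp [h])
  refine Finset.sum_pos' (fun w _ => mul_nonneg (Real.rpow_nonneg (cylProb_nonneg P _) _)
    (cylProb_nonneg Q _)) ⟨v, hv, mul_pos (Real.rpow_pos_of_pos ?_ _) hpos⟩
  exact (Finset.mem_filter.1 hv).2

/-- Power mean inequality with exponent `θ⁻¹ ≥ 1`. The weights Q[a] over the support of `P` sum to 1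
because the support of `Q` is contained in it. -/
lemma pressureSum_mul_le (hP : MeasurePreserving shift P P) (hQ : MeasurePreserving shift Q Q)
    (hsupp : seqSupport Q ⊆ seqSupport P) (α : ℝ) {θ : ℝ} (h0 : 0 < θ) (h1 : θ ≤ 1) (n : ℕ) :
    pressureSum P Q (θ * α) n ≤ pressureSum P Q α n ^ θ := by
  have h := Real.rpow_arith_mean_le_arith_mean_rpow
    (Finset.univ.filter fun v : Fin n → A => 0 < cylProb P (List.ofFn v))
    (fun v => cylProb Q (List.ofFn v)) (fun v => cylProb P (List.ofFn v) ^ (-(θ * α)))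
    (fun v _ => cylProb_nonneg Q _) (sum_cylProb_support hP hQ hsupp n)
    (fun v _ => Real.rpow_nonneg (cylProb_nonneg P _) _) (p := θ⁻¹) ((one_le_inv₀ h0).2 h1)
  have e1 : ∑ v : Fin n → A with 0 < cylProb P (List.ofFn v),
      cylProb Q (List.ofFn v) * cylProb P (List.ofFn v) ^ (-(θ * α)) =
        pressureSum P Q (θ * α) n := Finset.sum_congr rfl fun v _ => mul_comm _ _
  have e2 : ∑ v : Fin n → A with 0 < cylProb P (List.ofFn v),
      cylProb Q (List.ofFn v) * (cylProb P (List.ofFn v) ^ (-(θ * α))) ^ θ⁻¹ =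
        pressureSum P Q α n := Finset.sum_congr rfl fun v _ => by
    rw [mul_comm, ← Real.rpow_mul (cylProb_nonneg P _)]
    congr 2
    field_simp
  rw [e1, e2] at h
  calc pressureSum P Q (θ * α) n = (pressureSum P Q (θ * α) n ^ θ⁻¹) ^ θ := by
        rw [← Real.rpow_mul (pressureSum_pos hP hQ hsupp _ n).le, inv_mul_cancel₀ h0.ne',
          Real.rpow_one]
    _ ≤ _ := Real.rpow_le_rpow (Real.rpow_nonneg (pressureSum_pos hP hQ hsupp _ n).le _) h h0.le

lemma pressure_zero (hP : MeasurePreserving shift P P) (hQ : MeasurePreserving shift Q Q)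
    (hsupp : seqSupport Q ⊆ seqSupport P) : pressure P Q 0 = 0 := by
  have h : ∀ n, pressureSum P Q 0 n = 1 := fun n => by
    simp [pressureSum, sum_cylProb_support hP hQ hsupp n]
  simp [pressure, h]

lemma pressure_mul_le (hP : MeasurePreserving shift P P) (hQ : MeasurePreserving shift Q Q)
    (hsupp : seqSupport Q ⊆ seqSupport P) (α : ℝ) {θ : ℝ} (h0 : 0 < θ) (h1 : θ ≤ 1) :
    pressure P Q (θ * α) ≤ (θ : EReal) * pressure P Q α := by
  rw [pressure, pressure, ← EReal.limsup_const_mul_of_nonneg_of_ne_top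
    (EReal.coe_nonneg.2 h0.le) (EReal.coe_ne_top θ)]
  refine limsup_le_limsup (Eventually.of_forall fun n => ?_)
  beta_reduce
  rw [← EReal.coe_mul, EReal.coe_le_coe_iff]
  have hlog : Real.log (pressureSum P Q (θ * α) n) ≤ θ * Real.log (pressureSum P Q α n) := by
    rw [← Real.log_rpow (pressureSum_pos hP hQ hsupp α n)]
    exact Real.log_le_log (pressureSum_pos hP hQ hsupp _ n)
      (pressureSum_mul_le hP hQ hsupp α h0 h1 n)
  calc _ ≤ 1 / (n : ℝ) * (θ * Real.log (pressureSum P Q α n)) :=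
        mul_le_mul_of_nonneg_left hlog (by positivity)
    _ = _ := by ring

lemma coe_mul_div_coe_mul {θ a : ℝ} (hθ : θ ≠ 0) (x : EReal) :
    (θ : EReal) * x / ((θ * a : ℝ) : EReal) = x / (a : EReal) := by
  rw [EReal.div_eq_inv_mul, EReal.div_eq_inv_mul, ← mul_assoc, ← EReal.coe_inv, ← EReal.coe_inv,
    ← EReal.coe_mul, mul_inv, mul_assoc, mul_comm a⁻¹, ← mul_assoc, inv_mul_cancel₀ hθ, one_mul]

/-- The slope between `0` and `α` of the pressure. -/
noncomputable def pressureSlope (P Q : Measure (ℕ → A)) (α : ℝ) : EReal :=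
  pressure P Q α / (α : EReal)

/-- For `a ≤ b < 0`, write `b = θ a` with `θ = b / a` in (0, 1]. Dividing `pressure_mul_le` by the
negative number `b` reverses it into the comparison of slopes. -/
lemma monotoneOn_pressureSlope_Iio (hP : MeasurePreserving shift P P)
    (hQ : MeasurePreserving shift Q Q) (hsupp : seqSupport Q ⊆ seqSupport P) :
    MonotoneOn (pressureSlope P Q) (Set.Iio 0) := by
  intro a ha b hb hab
  simp only [Set.mem_Iio] at ha hb
  have hθ : 0 < b / a := div_pos_of_neg_of_neg hb ha
  have hθ1 : b / a ≤ 1 := (div_le_one_of_neg ha).2 hab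
  have h := pressure_mul_le hP hQ hsupp a hθ hθ1
  have e : b / a * a = b := div_mul_cancel₀ _ ha.ne
  have h2 := EReal.antitone_div_right_of_nonpos (b := ((b / a * a : ℝ) : EReal))
    (by rw [e]; exact_mod_cast hb.le) h
  simp only [coe_mul_div_coe_mul hθ.ne'] at h2
  rwa [e] at h2

lemma monotoneOn_pressureSlope_Ioi (hP : MeasurePreserving shift P P)
    (hQ : MeasurePreserving shift Q Q) (hsupp : seqSupport Q ⊆ seqSupport P) :
    MonotoneOn (pressureSlope P Q) (Set.Ioi 0) := by
  intro a ha b hb hab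
  simp only [Set.mem_Ioi] at ha hb
  have hθ : 0 < a / b := div_pos ha hb
  have hθ1 : a / b ≤ 1 := (div_le_one hb).2 hab
  have h := pressure_mul_le hP hQ hsupp b hθ hθ1
  have e : a / b * b = a := div_mul_cancel₀ _ hb.ne'
  have h2 := EReal.monotone_div_right_of_nonneg (b := ((a / b * b : ℝ) : EReal))
    (by rw [e]; exact_mod_cast ha.le) h
  simp only [coe_mul_div_coe_mul hθ.ne'] at h2
  rwa [e] at h2

lemma hasLeftDeriv_pressure (hP : MeasurePreserving shift P P)
    (hQ : MeasurePreserving shift Q Q) (hsupp : seqSupport Q ⊆ seqSupport P) :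
    HasLeftDeriv (pressure P Q) 0 (sSup (pressureSlope P Q '' Set.Iio 0)) := by
  unfold HasLeftDeriv
  simp only [pressure_zero hP hQ hsupp, sub_zero]
  exact (monotoneOn_pressureSlope_Iio hP hQ hsupp).tendsto_nhdsLT (OrderTop.bddAbove _)

lemma hasRightDeriv_pressure (hP : MeasurePreserving shift P P)
    (hQ : MeasurePreserving shift Q Q) (hsupp : seqSupport Q ⊆ seqSupport P) :
    HasRightDeriv (pressure P Q) 0 (sInf (pressureSlope P Q '' Set.Ioi 0)) := by
  unfold HasRightDeriv
  simp only [pressure_zero hP hQ hsupp, sub_zero]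
  exact (monotoneOn_pressureSlope_Ioi hP hQ hsupp).tendsto_nhdsGT (OrderBot.bddBelow _)

lemma eventually_pressureSum_le {α r : ℝ} (h : pressure P Q α < (r : EReal)) :
    ∀ᶠ n : ℕ in atTop, pressureSum P Q α n ≤ Real.exp (r * n) := by
  filter_upwards [eventually_lt_of_limsup_lt h, eventually_gt_atTop 0] with n hn hn0
  have hn0' : (0 : ℝ) < n := by exact_mod_cast hn0
  have h1 : 1 / (n : ℝ) * Real.log (pressureSum P Q α n) < r := by exact_mod_cast hn
  have h2 : Real.log (pressureSum P Q α n) < r * n := by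
    rwa [one_div, inv_mul_lt_iff₀ hn0', mul_comm] at h1
  rcases le_or_gt (pressureSum P Q α n) 0 with h0 | h0
  · exact h0.trans (Real.exp_pos _).le
  · exact ((Real.log_lt_iff_lt_exp h0).1 h2).le

/-- Turns a number below the left derivative into an exponential moment bound at one `α < 0`. -/
lemma exists_pressure_lt_of_lt_sSup {R : ℝ}
    (h : (R : EReal) < sSup (pressureSlope P Q '' Set.Iio 0)) :
    ∃ α < 0, pressure P Q α < ((α * R : ℝ) : EReal) := by
  obtain ⟨_, ⟨α, hα, rfl⟩, h⟩ := lt_sSup_iff.1 h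
  simp only [Set.mem_Iio] at hα
  refine ⟨α, hα, ?_⟩
  by_contra hc
  have h2 := EReal.antitone_div_right_of_nonpos (b := (α : EReal)) (by exact_mod_cast hα.le)
    (not_lt.1 hc)
  simp only at h2
  rw [← EReal.coe_div, mul_div_cancel_left₀ _ hα.ne] at h2
  exact absurd h (not_lt.2 h2)

lemma exists_pressure_lt_of_sInf_lt {R : ℝ}
    (h : sInf (pressureSlope P Q '' Set.Ioi 0) < (R : EReal)) :
    ∃ α > 0, pressure P Q α < ((α * R : ℝ) : EReal) := by
  obtain ⟨_, ⟨α, hα, rfl⟩, h⟩ := sInf_lt_iff.1 h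
  simp only [Set.mem_Ioi] at hα
  refine ⟨α, hα, ?_⟩
  by_contra hc
  have h2 := EReal.monotone_div_right_of_nonneg (b := (α : EReal)) (by exact_mod_cast hα.le)
    (not_lt.1 hc)
  simp only at h2
  rw [← EReal.coe_div, mul_div_cancel_left₀ _ hα.ne'] at h2
  exact absurd h (not_lt.2 h2)

/-- The pressure sum is a moment under `Q`. Words with P[a] = 0, where the real power takes a
conventional value, do not contribute since then Q[a] = 0 as well. -/
lemma lintegral_cylProb_rpow (hP : MeasurePreserving shift P P) (hQ : MeasurePreserving shift Q Q)
    (hsupp : seqSupport Q ⊆ seqSupport P) (α : ℝ) (s n : ℕ) :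
    ∫⁻ y, ENNReal.ofReal (cylProb P (word y s n) ^ (-α)) ∂Q =
      ENNReal.ofReal (pressureSum P Q α n) := by
  rw [lintegral_word hQ (fun a => ENNReal.ofReal (cylProb P a ^ (-α))), pressureSum,
    Finset.sum_filter, ENNReal.ofReal_sum_of_nonneg]
  · refine Finset.sum_congr rfl fun v _ => ?_
    rw [← ofReal_cylProb, ← ENNReal.ofReal_mul (Real.rpow_nonneg (cylProb_nonneg P _) _)]
    split_ifs with h
    · rfl
    · have : cylProb Q (List.ofFn v) = 0 := by
        by_contra hne
        exact h (cylProb_pos_of_subset hP hQ hsupp ((cylProb_nonneg Q _).lt_of_ne' hne))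
      rw [this, mul_zero]
  · intro v _
    split_ifs
    · exact mul_nonneg (Real.rpow_nonneg (cylProb_nonneg P _) _) (cylProb_nonneg Q _)
    · exact le_rfl

end Pressure

/-! ### Borel–Cantelli and Markov inequalities -/

section BorelCantelli

variable {Ω : Type*} [MeasurableSpace Ω] {μ : Measure Ω}

lemma ae_eventually_notMem_of_summable {s : ℕ → Set Ω} {b : ℕ → ℝ} (hb : Summable b)
    (h : ∀ᶠ n in atTop, μ (s n) ≤ ENNReal.ofReal (b n)) : ∀ᵐ x ∂μ, ∀ᶠ n in atTop, x ∉ s n := by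
  obtain ⟨n₀, hn₀⟩ := eventually_atTop.1 h
  have hb' : Summable fun n => b (n + n₀) := (summable_nat_add_iff n₀).2 hb
  have hs : ∑' n, μ (s (n + n₀)) ≠ ⊤ :=
    ((ENNReal.tsum_le_tsum fun n => hn₀ (n + n₀) (by omega)).trans_lt
      hb'.tsum_ofReal_lt_top).ne
  filter_upwards [ae_eventually_notMem hs] with x hx
  filter_upwards [(tendsto_sub_atTop_nat n₀).eventually hx, eventually_ge_atTop n₀] with n hn h
  rwa [Nat.sub_add_cancel h] at hn

lemma measure_ofReal_le_le {f : Ω → ENNReal} (hf : Measurable f) {b c : ℝ} (hc : 0 < c)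
    (h : ∫⁻ x, f x ∂μ ≤ ENNReal.ofReal b) :
    μ {x | ENNReal.ofReal c ≤ f x} ≤ ENNReal.ofReal (b / c) := by
  refine (meas_ge_le_lintegral_div hf.aemeasurable (ENNReal.ofReal_pos.2 hc).ne'
    ENNReal.ofReal_ne_top).trans ?_
  rw [ENNReal.ofReal_div_of_pos hc]
  gcongr

end BorelCantelli

/-! ### Upper decoupling and the expectation of gap sums -/

section Decoupling

variable {A : Type*} [Fintype A] [MeasurableSpace A] [MeasurableSingletonClass A]
variable {Q : Measure (ℕ → A)} [IsProbabilityMeasure Q]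

/-- The inequality of upper decoupling at the length `n`, for a gap of length `t`. -/
def DecoupledAt (Q : Measure (ℕ → A)) (n t : ℕ) (κ : ℝ) : Prop :=
  ∀ a ∈ wordSupport Q n, ∀ ξ ∈ wordSupport Q t, ∀ m : ℕ, 1 ≤ m → ∀ b ∈ wordSupport Q m,
    cylProb Q (a ++ ξ ++ b) ≤ Real.exp κ * (cylProb Q a * cylProb Q b)

/-- The support conditions can be dropped: if the concatenation has positive probability, so do its
three pieces, and otherwise the left side vanishes. -/
lemma DecoupledAt.cylProb_le (hQ : MeasurePreserving shift Q Q) {n t : ℕ} {κ : ℝ}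
    (h : DecoupledAt Q n t κ) {a ξ b : List A} (ha : a.length = n) (hξ : ξ.length = t)
    (hb : 1 ≤ b.length) :
    cylProb Q (a ++ ξ ++ b) ≤ Real.exp κ * (cylProb Q a * cylProb Q b) := by
  have hnn : 0 ≤ Real.exp κ * (cylProb Q a * cylProb Q b) :=
    mul_nonneg (Real.exp_pos _).le (mul_nonneg (cylProb_nonneg Q _) (cylProb_nonneg Q _))
  rcases (cylProb_nonneg Q (a ++ ξ ++ b)).eq_or_lt with h0 | h0
  · rwa [← h0]
  · have hb0 : 0 < cylProb Q b := h0.trans_le (cylProb_append_le_right hQ _ _)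
    have h1 : 0 < cylProb Q (a ++ ξ) := h0.trans_le (cylProb_append_le_left Q _ _)
    exact h a ⟨ha, h1.trans_le (cylProb_append_le_left Q _ _)⟩ ξ
      ⟨hξ, h1.trans_le (cylProb_append_le_right hQ _ _)⟩ _ hb b ⟨rfl, hb0⟩

/-- Decoupling is applied to every gap word separately; summing over the at most |A|^t gap words
gives the factor `Fintype.card A ^ t`. -/
lemma DecoupledAt.lintegral_mul_le (hQ : MeasurePreserving shift Q Q) {n t : ℕ} {κ : ℝ}
    (h : DecoupledAt Q n t κ) (F : List A → ENNReal) {G : (ℕ → A) → ENNReal} {M : ℕ}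
    (hG : ∀ y y' : ℕ → A, (∀ i < M, y i = y' i) → G y = G y') :
    ∫⁻ y, F (word y 0 n) * G (shift^[n + t] y) ∂Q ≤
      ENNReal.ofReal (Real.exp κ * (Fintype.card A : ℝ) ^ t) *
        ((∫⁻ y, F (word y 0 n) ∂Q) * ∫⁻ y, G y ∂Q) := by
  have hA : Nonempty A := by
    obtain ⟨y⟩ := nonempty_of_isProbabilityMeasure Q
    exact ⟨y 0⟩
  -- Decoupling needs a nonempty right-hand word, so the window of `G` is enlarged by one letter in
  -- case `M = 0`.
  replace hG : ∀ y y' : ℕ → A, (∀ i < M + 1, y i = y' i) → G y = G y' :=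
    fun y y' hy => hG y y' fun i hi => hy i (by omega)
  generalize hM : M + 1 = M' at hG
  have hM1 : 1 ≤ M' := by omega
  set G' : List A → ENNReal := fun a => G (fun i => a.getD i (Classical.arbitrary A)) with hG'
  have hGw : ∀ y, G y = G' (word y 0 M') := fun y => hG _ _ fun i hi => by
    simp [word, hi]
  have hmeas : Measurable fun y : ℕ → A => ((fun i : Fin n => y (0 + i)),
      (fun i : Fin t => y (n + i)), (fun i : Fin M' => y (n + t + i))) :=
    (measurable_window 0 n).prodMk ((measurable_window n t).prodMk (measurable_window (n + t) M'))
  have e1 : ∀ y, F (word y 0 n) * G (shift^[n + t] y) =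
      (fun w : (Fin n → A) × (Fin t → A) × (Fin M' → A) =>
        F (List.ofFn w.1) * G' (List.ofFn w.2.2)) ((fun i : Fin n => y (0 + i)),
      (fun i : Fin t => y (n + i)), (fun i : Fin M' => y (n + t + i))) := fun y => by
    simp only
    rw [hGw, word_shift_iterate, Nat.add_zero, word_eq_ofFn, word_eq_ofFn]
  have key : ∀ w : (Fin n → A) × (Fin t → A) × (Fin M' → A),
      Measure.map (fun y : ℕ → A => ((fun i : Fin n => y (0 + i)),
        (fun i : Fin t => y (n + i)), (fun i : Fin M' => y (n + t + i)))) Q {w} ≤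
      ENNReal.ofReal (Real.exp κ) *
        (Q (wordCylinder (List.ofFn w.1)) * Q (wordCylinder (List.ofFn w.2.2))) := by
    rintro ⟨u, ξ, v⟩
    rw [Measure.map_apply hmeas (measurableSet_singleton _)]
    have : (fun y : ℕ → A => ((fun i : Fin n => y (0 + i)), (fun i : Fin t => y (n + i)),
        (fun i : Fin M' => y (n + t + i)))) ⁻¹' {(u, ξ, v)} =
        wordCylinder (List.ofFn u ++ List.ofFn ξ ++ List.ofFn v) := by
      ext y
      rw [mem_wordCylinder_iff, word_eq_append_iff, word_eq_append_iff]
      simp only [Set.mem_preimage, Set.mem_singleton_iff, Prod.mk.injEq, List.length_append,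
        List.length_ofFn, word_eq_ofFn_iff, Nat.zero_add, and_assoc]
    rw [this, ← ofReal_cylProb, ← ofReal_cylProb, ← ofReal_cylProb,
      ← ENNReal.ofReal_mul (cylProb_nonneg Q _), ← ENNReal.ofReal_mul (Real.exp_pos _).le]
    exact ENNReal.ofReal_le_ofReal (h.cylProb_le hQ (by simp) (by simp) (by simpa using hM1))
  have e2 : ∫⁻ y, G y ∂Q =
      ∑ v : Fin M' → A, G' (List.ofFn v) * Q (wordCylinder (List.ofFn v)) := by
    simp_rw [hGw]
    exact lintegral_word hQ G' 0 M'
  simp_rw [e1]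
  rw [← lintegral_map (f := fun w : (Fin n → A) × (Fin t → A) × (Fin M' → A) =>
        F (List.ofFn w.1) * G' (List.ofFn w.2.2)) Measurable.of_discrete hmeas,
    lintegral_fintype, lintegral_word hQ F 0 n, e2]
  refine (Finset.sum_le_sum fun w _ => mul_le_mul_right (key w) _).trans_eq ?_
  simp only [Fintype.sum_prod_type, Finset.sum_const, Finset.card_univ, Fintype.card_fun,
    Fintype.card_fin, nsmul_eq_mul]
  rw [Finset.sum_mul_sum, Finset.mul_sum]
  refine Finset.sum_congr rfl fun u _ => ?_
  rw [Finset.mul_sum, Finset.mul_sum]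
  refine Finset.sum_congr rfl fun v _ => ?_
  rw [ENNReal.ofReal_mul (Real.exp_pos _).le, ENNReal.ofReal_pow (by positivity),
    ENNReal.ofReal_natCast]
  push_cast
  ring

/-- The sum, over the families of subwords of `y₁ … y_N` that have lengths above `m` and are
followed by gaps of the lengths prescribed by `τ`, of the products of the weights `g`. -/
noncomputable def gapSum (g : List A → ENNReal) (τ : ℕ → ℕ) (m : ℕ) : ℕ → (ℕ → A) → ENNReal
  | 0, _ => 1
  | N + 1, y => gapSum g τ m N (shift y) + ∑ i ∈ Finset.range (N + 1 - m),
      g (word y 0 (m + 1 + i)) *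
        gapSum g τ m (N - (m + i + τ (m + 1 + i))) (shift^[m + 1 + i + τ (m + 1 + i)] y)

lemma gapSum_local (g : List A → ENNReal) (τ : ℕ → ℕ) (m N : ℕ) (y y' : ℕ → A)
    (h : ∀ i < N, y i = y' i) : gapSum g τ m N y = gapSum g τ m N y' := by
  induction N using Nat.strong_induction_on generalizing y y' with
  | _ N ih =>
    cases N with
    | zero => simp [gapSum]
    | succ N =>
      rw [gapSum, gapSum, ih N (by omega) (shift y) (shift y') fun i hi => h _ (by omega)]
      congr 1
      refine Finset.sum_congr rfl fun i hi => ?_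
      rw [Finset.mem_range] at hi
      rw [word_eq_word_iff.2 fun j hj => h (0 + j) (by omega),
        ih (N - (m + i + τ (m + 1 + i))) (by omega) _ (shift^[m + 1 + i + τ (m + 1 + i)] y')]
      intro j hj
      simp only [shift_iterate_apply]
      exact h _ (by omega)

lemma measurable_gapSum (g : List A → ENNReal) (τ : ℕ → ℕ) (m N : ℕ) :
    Measurable (gapSum g τ m N) := measurable_of_local N (gapSum_local g τ m N)

lemma one_le_gapSum (g : List A → ENNReal) (τ : ℕ → ℕ) (m N : ℕ) (y : ℕ → A) :
    1 ≤ gapSum g τ m N y := by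
  induction N generalizing y with
  | zero => simp [gapSum]
  | succ N ih => exact (ih _).trans (by rw [gapSum]; exact le_self_add)

/-- A family of subwords of a suffix is also a family of subwords of a longer suffix, and all
weights are nonnegative. -/
lemma gapSum_anti (g : List A → ENNReal) (τ : ℕ → ℕ) (m N : ℕ) (y : ℕ → A) :
    Antitone fun p => gapSum g τ m (N - p) (shift^[p] y) := by
  refine antitone_nat_of_succ_le fun p => ?_
  rcases lt_or_ge p N with h | h
  · obtain ⟨d, rfl⟩ := Nat.exists_eq_add_of_lt h
    have e1 : p + d + 1 - (p + 1) = d := by omega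
    have e2 : p + d + 1 - p = d + 1 := by omega
    simp only [e1, e2, gapSum, ← Function.iterate_succ_apply' shift p y]
    exact le_self_add
  · have e1 : N - (p + 1) = 0 := by omega
    have e2 : N - p = 0 := by omega
    simp only [e1, e2, gapSum]
    exact le_rfl

lemma mul_gapSum_le (g : List A → ENNReal) (τ : ℕ → ℕ) {m N : ℕ} (y : ℕ → A) {p l p' : ℕ}
    (hl : m < l) (hN : p + l ≤ N) (hp : p + l + τ l ≤ p') :
    g (word y p l) * gapSum g τ m (N - p') (shift^[p'] y) ≤
      gapSum g τ m (N - p) (shift^[p] y) := by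
  refine (mul_le_mul_right (gapSum_anti g τ m N y hp) _).trans ?_
  obtain ⟨i, rfl⟩ := Nat.exists_eq_add_of_lt hl
  obtain ⟨d, rfl⟩ := Nat.exists_eq_add_of_le hN
  have e2 : p + (m + i + 1) + d - p = (m + i + d) + 1 := by omega
  rw [e2, gapSum]
  refine le_add_left ?_
  have hi : i ∈ Finset.range (m + i + d + 1 - m) := by simp; omega
  refine le_trans ?_ (Finset.single_le_sum (fun _ _ => zero_le) hi)
  have e3 : m + 1 + i = m + i + 1 := by omega
  have e4 : p + (m + i + 1) + d - (p + (m + i + 1) + τ (m + i + 1)) =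
      m + i + d - (m + i + τ (m + i + 1)) := by omega
  have e5 : m + i + 1 + τ (m + i + 1) + p = p + (m + i + 1) + τ (m + i + 1) := by omega
  rw [e3, word_shift_iterate, ← Function.iterate_add_apply, Nat.add_zero, e5]
  simp only [e4]
  exact le_rfl

/-- The product is one of the terms of the sum, up to larger gaps. The induction carries along the
gap sum of the suffix that starts at `p c`; indices outside `I` merely move the start. -/
lemma prod_le_gapSum (g : List A → ENNReal) (τ : ℕ → ℕ) {m N : ℕ} (y : ℕ → A) (I : Set ℕ)
    [DecidablePred (· ∈ I)] (p l : ℕ → ℕ) (c : ℕ) (hp : ∀ i < c, p i ≤ p (i + 1))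
    (hI : ∀ i < c, i ∈ I → m < l i ∧ p i + l i ≤ N ∧ p i + l i + τ (l i) ≤ p (i + 1)) :
    ∏ i ∈ Finset.range c with i ∈ I, g (word y (p i) (l i)) ≤ gapSum g τ m N y := by
  have key : (∏ i ∈ Finset.range c with i ∈ I, g (word y (p i) (l i))) *
      gapSum g τ m (N - p c) (shift^[p c] y) ≤ gapSum g τ m (N - p 0) (shift^[p 0] y) := by
    induction c with
    | zero => simp
    | succ c ih =>
      refine le_trans ?_ (ih (fun i hi => hp i (by omega)) fun i hi => hI i (by omega))
      rw [Finset.prod_filter, Finset.prod_filter, Finset.prod_range_succ, mul_assoc]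
      refine mul_le_mul_right ?_ _
      split_ifs with hc
      · obtain ⟨h1, h2, h3⟩ := hI c (by omega) hc
        exact mul_gapSum_le g τ y h1 h2 h3
      · rw [one_mul]
        exact gapSum_anti g τ m N y (hp c (by omega))
  calc _ ≤ _ := le_mul_of_one_le_right' (one_le_gapSum g τ m (N - p c) (shift^[p c] y))
    _ ≤ _ := key
    _ ≤ gapSum g τ m (N - 0) (shift^[0] y) := gapSum_anti g τ m N y (Nat.zero_le _)
    _ = _ := by simp

/-- In the recursion, decoupling separates the first word from the rest. Its weight, decoupling
factor included, is at most `e i`, so passing from `N` to `N + 1` costs at most a factor `1 + η`. -/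
lemma lintegral_gapSum_le (hQ : MeasurePreserving shift Q Q) (g : List A → ENNReal)
    {τ : ℕ → ℕ} {κ : ℕ → ℝ} (hdec : ∀ n, 1 ≤ n → DecoupledAt Q n (τ n) (κ n)) {m : ℕ}
    {η : ENNReal} (e : ℕ → ENNReal) (he : ∀ n, ∑ i ∈ Finset.range n, e i ≤ η)
    (hg : ∀ i, ENNReal.ofReal (Real.exp (κ (m + 1 + i)) *
      (Fintype.card A : ℝ) ^ τ (m + 1 + i)) * ∫⁻ y, g (word y 0 (m + 1 + i)) ∂Q ≤ e i) (N : ℕ) :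
    ∫⁻ y, gapSum g τ m N y ∂Q ≤ (1 + η) ^ N := by
  induction N using Nat.strong_induction_on with
  | _ N ih =>
    cases N with
    | zero => simp [gapSum]
    | succ N =>
      simp_rw [gapSum]
      have hm : ∀ i, Measurable fun y : ℕ → A => g (word y 0 (m + 1 + i)) *
          gapSum g τ m (N - (m + i + τ (m + 1 + i))) (shift^[m + 1 + i + τ (m + 1 + i)] y) :=
        fun i => (measurable_word_comp g _ _).mul
          ((measurable_gapSum g τ m _).comp (measurable_shift.iterate _))
      rw [lintegral_add_left (f := fun y => gapSum g τ m N (shift y))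
          ((measurable_gapSum g τ m N).comp measurable_shift),
        lintegral_finsetSum _ fun i _ => hm i,
        hQ.lintegral_comp (measurable_gapSum g τ m N)]
      have h1 : (1 : ENNReal) ≤ 1 + η := le_self_add
      calc _ ≤ (1 + η) ^ N + ∑ i ∈ Finset.range (N + 1 - m), e i * (1 + η) ^ N := by
            refine add_le_add (ih N (by omega)) (Finset.sum_le_sum fun i _ => ?_)
            refine ((hdec (m + 1 + i) (by omega)).lintegral_mul_le hQ g
              (gapSum_local g τ m _)).trans ?_
            rw [← mul_assoc]
            refine mul_le_mul' (hg i) ((ih _ (by omega)).trans ?_)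
            exact pow_le_pow_right₀ h1 (by omega)
        _ ≤ (1 + η) ^ N + η * (1 + η) ^ N := by
            rw [← Finset.sum_mul]
            gcongr
            exact he _
        _ = _ := by ring

end Decoupling

/-! ### Almost sure bounds uniform over separated subwords -/

section DecouplingBound

variable {A : Type*} [Fintype A] [MeasurableSpace A] [MeasurableSingletonClass A]
variable {Q : Measure (ℕ → A)} [IsProbabilityMeasure Q]

lemma eventually_le_mul_of_isLittleO {u : ℕ → ℝ} (hu : u =o[atTop] fun n : ℕ => (n : ℝ)) {ε : ℝ}
    (hε : 0 < ε) : ∀ᶠ n : ℕ in atTop, u n ≤ ε * n := by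
  filter_upwards [hu.def hε] with n hn
  exact (le_abs_self _).trans (by simpa using hn)

lemma exists_le_mul_add_of_isLittleO {u : ℕ → ℝ} (hu : u =o[atTop] fun n : ℕ => (n : ℝ)) {ε : ℝ}
    (hε : 0 < ε) : ∃ C : ℝ, 0 ≤ C ∧ ∀ n : ℕ, u n ≤ ε * n + C := by
  obtain ⟨n₀, hn₀⟩ := eventually_atTop.1 (eventually_le_mul_of_isLittleO hu hε)
  refine ⟨∑ i ∈ Finset.range n₀, |u i|, Finset.sum_nonneg fun i _ => abs_nonneg _, fun n => ?_⟩
  rcases le_or_gt n₀ n with h | h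
  · exact (hn₀ n h).trans (le_add_of_nonneg_right (Finset.sum_nonneg fun i _ => abs_nonneg _))
  · have h1 : |u n| ≤ ∑ i ∈ Finset.range n₀, |u i| :=
      Finset.single_le_sum (f := fun i => |u i|) (fun i _ => abs_nonneg _) (Finset.mem_range.2 h)
    have h2 : 0 ≤ ε * (n : ℝ) := by positivity
    linarith [le_abs_self (u n)]

lemma sum_range_pow_add_le {r : ℝ} (h0 : 0 ≤ r) (h1 : r < 1) (m n : ℕ) :
    ∑ i ∈ Finset.range n, r ^ (m + i) ≤ r ^ m * (1 - r)⁻¹ := by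
  simp_rw [pow_add]
  rw [← Finset.mul_sum]
  refine mul_le_mul_of_nonneg_left ?_ (pow_nonneg h0 m)
  rw [← tsum_geometric_of_lt_one h0 h1]
  exact (summable_geometric_of_lt_one h0 h1).sum_le_tsum _ fun i _ => pow_nonneg h0 i

/-- Of the discount e^{-(ρ+ε)n}, the part e^{-ρn} cancels the moment, half of the rest absorbs the
subexponential decoupling factor, and r^n with r = e^{-ε/2} remains. For `m` large the tail of this
geometric series is at most ε/2, so the expectation is at most e^{εN/2}, which Markov's inequality
compares with e^{εN}. -/
lemma ae_eventually_gapSum_le (hQ : MeasurePreserving shift Q Q) {τ : ℕ → ℕ} {κ : ℕ → ℝ}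
    (hκ : κ =o[atTop] fun n : ℕ => (n : ℝ))
    (hτ : (fun n => (τ n : ℝ)) =o[atTop] fun n : ℕ => (n : ℝ))
    (hdec : ∀ n, 1 ≤ n → DecoupledAt Q n (τ n) (κ n)) {f : List A → ℝ} {ρ ε : ℝ} (hε : 0 < ε)
    (hf : ∀ᶠ n : ℕ in atTop,
      ∫⁻ y, ENNReal.ofReal (f (word y 0 n)) ∂Q ≤ ENNReal.ofReal (Real.exp (ρ * n))) :
    ∃ m : ℕ, ∀ᵐ y ∂Q, ∀ᶠ N : ℕ in atTop,
      gapSum (fun a => ENNReal.ofReal (f a * Real.exp (-(ρ + ε) * a.length))) τ m N y ≤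
        ENNReal.ofReal (Real.exp (ε * N)) := by
  set r : ℝ := Real.exp (-(ε / 2)) with hr
  have hr0 : 0 < r := Real.exp_pos _
  have hr1 : r < 1 := by rw [hr, Real.exp_lt_one_iff]; linarith
  have hA : Nonempty A := by
    obtain ⟨y⟩ := nonempty_of_isProbabilityMeasure Q
    exact ⟨y 0⟩
  have hcard : (1 : ℝ) ≤ Fintype.card A := by exact_mod_cast Fintype.card_pos
  have hlog : 0 ≤ Real.log (Fintype.card A) := Real.log_nonneg hcard
  have hC : ∀ᶠ n : ℕ in atTop,
      Real.exp (κ n) * (Fintype.card A : ℝ) ^ τ n ≤ Real.exp (ε / 2 * n) := by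
    have hτ' : (fun n => Real.log (Fintype.card A) * (τ n : ℝ)) =o[atTop] fun n : ℕ => (n : ℝ) :=
      hτ.const_mul_left _
    filter_upwards [eventually_le_mul_of_isLittleO hκ (ε := ε / 4) (by linarith),
      eventually_le_mul_of_isLittleO hτ' (ε := ε / 4) (by linarith)] with n h1 h2
    rw [← Real.exp_log (zero_lt_one.trans_le hcard), ← Real.exp_nat_mul, ← Real.exp_add,
      Real.exp_le_exp]
    linarith
  have htail : ∀ᶠ m : ℕ in atTop, r ^ (m + 1) * (1 - r)⁻¹ ≤ ε / 2 := by
    have h : Tendsto (fun m : ℕ => r ^ (m + 1) * (1 - r)⁻¹) atTop (𝓝 (0 * (1 - r)⁻¹)) :=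
      ((tendsto_pow_atTop_nhds_zero_of_lt_one hr0.le hr1).comp (tendsto_add_atTop_nat 1)).mul_const _
    rw [zero_mul] at h
    exact h.eventually_le_const (by linarith)
  obtain ⟨n₀, hn₀⟩ := eventually_atTop.1 (hf.and hC)
  obtain ⟨m, hm, hmn⟩ := (htail.and (eventually_ge_atTop n₀)).exists
  refine ⟨m, ?_⟩
  set g : List A → ENNReal :=
    fun a => ENNReal.ofReal (f a * Real.exp (-(ρ + ε) * a.length)) with hg
  have hint : ∀ N, ∫⁻ y, gapSum g τ m N y ∂Q ≤ ENNReal.ofReal (Real.exp (ε / 2 * N)) := by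
    intro N
    refine (lintegral_gapSum_le hQ g hdec (m := m) (η := ENNReal.ofReal (ε / 2))
      (fun i => ENNReal.ofReal (r ^ (m + 1 + i))) (fun n => ?_) (fun i => ?_) N).trans ?_
    · rw [← ENNReal.ofReal_sum_of_nonneg fun i _ => by positivity]
      exact ENNReal.ofReal_le_ofReal ((sum_range_pow_add_le hr0.le hr1 (m + 1) n).trans hm)
    · obtain ⟨h1, h2⟩ := hn₀ (m + 1 + i) (by omega)
      have e1 : ∀ y, g (word y 0 (m + 1 + i)) =
          ENNReal.ofReal (Real.exp (-(ρ + ε) * (m + 1 + i : ℕ))) *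
            ENNReal.ofReal (f (word y 0 (m + 1 + i))) := fun y => by
        rw [hg, ← ENNReal.ofReal_mul (Real.exp_pos _).le, mul_comm (Real.exp _)]
        simp only [length_word]
      simp_rw [e1]
      rw [lintegral_const_mul _
        (measurable_word_comp (fun a => ENNReal.ofReal (f a)) 0 (m + 1 + i))]
      refine (mul_le_mul' (ENNReal.ofReal_le_ofReal h2) (mul_le_mul_right h1 _)).trans_eq ?_
      rw [← ENNReal.ofReal_mul (Real.exp_pos _).le, ← ENNReal.ofReal_mul (Real.exp_pos _).le,
        ← Real.exp_add, ← Real.exp_add, hr, ← Real.exp_nat_mul]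
      congr 2
      ring
    · have : (1 + ENNReal.ofReal (ε / 2)) ^ N = ENNReal.ofReal ((1 + ε / 2) ^ N) := by
        rw [ENNReal.ofReal_pow (by linarith), ENNReal.ofReal_add zero_le_one (by linarith),
          ENNReal.ofReal_one]
      rw [this]
      refine ENNReal.ofReal_le_ofReal ?_
      rw [mul_comm (ε / 2), Real.exp_nat_mul]
      refine pow_le_pow_left₀ (by linarith) ?_ N
      linarith [Real.add_one_le_exp (ε / 2)]
  have hBC := ae_eventually_notMem_of_summable (μ := Q)
    (s := fun N => {y | ENNReal.ofReal (Real.exp (ε * N)) ≤ gapSum g τ m N y})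
    (summable_geometric_of_lt_one hr0.le hr1) (Eventually.of_forall fun N =>
      (measure_ofReal_le_le (measurable_gapSum g τ m N) (Real.exp_pos _) (hint N)).trans_eq (by
        rw [← Real.exp_sub, hr, ← Real.exp_nat_mul]
        congr 2
        ring))
  filter_upwards [hBC] with y hy
  filter_upwards [hy] with N hN
  exact (not_le.1 hN).le

/-- Under upper decoupling, sums of logarithms along well-separated subwords obey, almost surely
and uniformly in the subwords, the exponential bounds of the expectations. -/
theorem UpperDecoupled.ae_eventually_sum_log_le (hQ : MeasurePreserving shift Q Q)
    (hUD : UpperDecoupled Q) :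
    ∃ τ : ℕ → ℕ, ((fun n => (τ n : ℝ)) =o[atTop] fun n : ℕ => (n : ℝ)) ∧
      ∀ (f : List A → ℝ) (ρ ε : ℝ), 0 < ε →
      (∀ᶠ n : ℕ in atTop,
        ∫⁻ y, ENNReal.ofReal (f (word y 0 n)) ∂Q ≤ ENNReal.ofReal (Real.exp (ρ * n))) →
      ∃ m : ℕ, ∀ᵐ y ∂Q, ∀ᶠ N : ℕ in atTop, ∀ (c : ℕ) (I : Finset ℕ) (p l : ℕ → ℕ),
        (∀ i < c, p i ≤ p (i + 1)) →
        (∀ i < c, i ∈ I → m < l i ∧ p i + l i ≤ N ∧ p i + l i + τ (l i) ≤ p (i + 1) ∧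
          0 < f (word y (p i) (l i))) →
        ∑ i ∈ Finset.range c with i ∈ I, Real.log (f (word y (p i) (l i))) ≤
          (ρ + ε) * ∑ i ∈ Finset.range c with i ∈ I, (l i : ℝ) + ε * N := by
  obtain ⟨κ, τ, ⟨-, hκ, hτ⟩, hdec⟩ := hUD
  refine ⟨τ, hτ, fun f ρ ε hε hf => ?_⟩
  obtain ⟨m, hm⟩ := ae_eventually_gapSum_le hQ hκ hτ hdec hε hf
  refine ⟨m, ?_⟩
  filter_upwards [hm] with y hy
  filter_upwards [hy] with N hN c I p l hp hI
  have hpos : ∀ i ∈ (Finset.range c).filter (· ∈ I), 0 < f (word y (p i) (l i)) := fun i hi => by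
    obtain ⟨h1, h2⟩ := Finset.mem_filter.1 hi
    exact (hI i (Finset.mem_range.1 h1) h2).2.2.2
  have h := (prod_le_gapSum (fun a => ENNReal.ofReal (f a * Real.exp (-(ρ + ε) * a.length))) τ y
    (↑I) p l c hp fun i hi hiI => ⟨(hI i hi hiI).1, (hI i hi hiI).2.1, (hI i hi hiI).2.2.1⟩).trans hN
  simp only [Finset.mem_coe] at h
  rw [← ENNReal.ofReal_prod_of_nonneg fun i hi => (mul_pos (hpos i hi) (Real.exp_pos _)).le,
    ENNReal.ofReal_le_ofReal_iff (Real.exp_pos _).le,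
    ← Real.log_le_iff_le_exp (Finset.prod_pos fun i hi => mul_pos (hpos i hi) (Real.exp_pos _)),
    Real.log_prod fun i hi => (mul_pos (hpos i hi) (Real.exp_pos _)).ne'] at h
  have e : ∑ i ∈ Finset.range c with i ∈ I,
      Real.log (f (word y (p i) (l i)) * Real.exp (-(ρ + ε) * (word y (p i) (l i)).length)) =
      ∑ i ∈ Finset.range c with i ∈ I, Real.log (f (word y (p i) (l i))) +
        ∑ i ∈ Finset.range c with i ∈ I, -(ρ + ε) * (l i : ℝ) := by
    rw [← Finset.sum_add_distrib]
    refine Finset.sum_congr rfl fun i hi => ?_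
    rw [Real.log_mul (hpos i hi).ne' (Real.exp_pos _).ne', Real.log_exp, length_word]
  rw [e, ← Finset.mul_sum] at h
  linarith

end DecouplingBound

/-! ### Occurrence of words under selective lower decoupling -/

section Occurrence

variable {A : Type*} [Fintype A] [MeasurableSpace A] [MeasurableSingletonClass A]
variable {P : Measure (ℕ → A)} [IsProbabilityMeasure P]

/-- The sequences whose first `N` letters do not contain the word `a`. -/
def avoiding (a : List A) (N : ℕ) : Set (ℕ → A) :=
  {x | ∀ r, r + a.length ≤ N → word x r a.length ≠ a}

lemma mem_avoiding_congr {a : List A} {N : ℕ} {x y : ℕ → A} (h : ∀ i < N, x i = y i) :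
    x ∈ avoiding a N ↔ y ∈ avoiding a N := by
  refine forall₂_congr fun r hr => ?_
  rw [word_eq_word_iff.2 fun i hi => h (r + i) (by omega)]

lemma avoiding_anti (a : List A) {N N' : ℕ} (h : N ≤ N') : avoiding a N' ⊆ avoiding a N :=
  fun _ hx r hr => hx r (hr.trans h)

lemma measureReal_eq_sum_window (S : Set (ℕ → A)) (s l : ℕ) :
    P.real S = ∑ v : Fin l → A, P.real ({x | word x s l = List.ofFn v} ∩ S) := by
  have h := sum_measure_preimage_singleton (μ := P.restrict S) (Finset.univ : Finset (Fin l → A))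
    (f := fun y i => y (s + i)) fun v _ => measurable_window s l (measurableSet_singleton v)
  simp only [Finset.coe_univ, Set.preimage_univ, Measure.restrict_apply_univ] at h
  rw [measureReal_def, ← h, ENNReal.toReal_sum fun v _ => measure_ne_top _ _]
  refine Finset.sum_congr rfl fun v _ => ?_
  rw [Measure.restrict_apply (measurable_window s l (measurableSet_singleton v)), measureReal_def]
  congr 3
  ext x
  exact word_eq_ofFn_iff.symm

/-- The inequality of selective lower decoupling at the length `n`. -/
def SelectivelyDecoupledAt (P : Measure (ℕ → A)) (n t : ℕ) (κ : ℝ) : Prop :=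
  ∀ a ∈ wordSupport P n, ∀ m : ℕ, 1 ≤ m → ∀ b ∈ wordSupport P m,
    ∃ l : ℕ, l ≤ t ∧ ∃ ξ ∈ wordSupport P l,
      Real.exp (-κ) * (cylProb P a * cylProb P b) ≤ cylProb P (a ++ ξ ++ b)

lemma measureReal_word_eq (hP : MeasurePreserving shift P P) (s : ℕ) (a : List A) :
    P.real {y | word y s a.length = a} = cylProb P a := by
  rw [cylProb, measureReal_def, measureReal_def, measure_word_eq hP]

/-- Fix the word b in the last `m` letters, itself free of `a`. Selective decoupling provides a gap
word for which `a`, gap and b together have probability at least e^{-κ} P[a] P[b], and the `a.length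
+ t` letters in front of b leave room for this occurrence of `a`. -/
lemma SelectivelyDecoupledAt.measureReal_avoiding_add_le (hP : MeasurePreserving shift P P)
    {t : ℕ} {κ : ℝ} (hκ : 0 ≤ κ) {a : List A} (h : SelectivelyDecoupledAt P a.length t κ)
    (ha : 0 < cylProb P a) {m : ℕ} (hm : 1 ≤ m) :
    P.real (avoiding a (m + (a.length + t))) ≤
      (1 - Real.exp (-κ) * cylProb P a) * P.real (avoiding a m) := by
  set d := a.length + t with hd
  have hu : Real.exp (-κ) * cylProb P a ≤ 1 := by
    have h1 : Real.exp (-κ) ≤ 1 := Real.exp_le_one_iff.2 (by linarith)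
    exact mul_le_one₀ h1 (cylProb_nonneg P _) (cylProb_le_one P _)
  rw [measureReal_eq_sum_window (avoiding a (m + d)) d m,
    measureReal_eq_sum_window (avoiding a m) 0 m, Finset.mul_sum]
  refine Finset.sum_le_sum fun v _ => ?_
  set b := List.ofFn v with hb
  have hbl : b.length = m := by simp [hb]
  rcases Set.eq_empty_or_nonempty ({x | word x d m = b} ∩ avoiding a (m + d)) with h0 | ⟨x, hx, hxa⟩
  · rw [h0, measureReal_empty]
    exact mul_nonneg (by linarith) measureReal_nonneg
  have hsub : {x : ℕ → A | word x 0 m = b} ∩ avoiding a m = {x | word x 0 b.length = b} := by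
    rw [hbl]
    refine Set.inter_eq_left.2 fun y hy => ?_
    have hxd : shift^[d] x ∈ avoiding a m := fun r hr => by
      rw [word_shift_iterate]
      exact hxa _ (by omega)
    refine (mem_avoiding_congr fun i hi => ?_).2 hxd
    have hyx : word y 0 m = word x d m := by rw [hx, hy]
    simpa using word_eq_word_iff.1 hyx i hi
  rw [hsub, measureReal_word_eq hP]
  have hPb : P.real {x | word x d m = b} = cylProb P b := by
    rw [← measureReal_word_eq hP d b, hbl]
  rcases (cylProb_nonneg P b).eq_or_lt with hb0 | hb0
  · rw [← hb0, mul_zero]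
    exact (measureReal_mono Set.inter_subset_left).trans_eq (hPb.trans hb0.symm)
  obtain ⟨j, hj, ξ, ⟨hξ, -⟩, hle⟩ := h a ⟨rfl, ha⟩ m hm b ⟨hbl, hb0⟩
  -- The gap has length `j ≤ t`; starting `a` at `t - j` makes `b` start exactly at `d`, whatever
  -- `j` is.
  set E : Set (ℕ → A) := {x | word x (t - j) (a ++ ξ ++ b).length = a ++ ξ ++ b} with hE
  have hEsub : E ⊆ {x | word x d m = b} := fun y hy => by
    have := (word_eq_append_iff.1 hy).2
    rw [List.length_append, hξ, hbl] at this
    rw [Set.mem_ofPred_eq, ← this]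
    congr 1
    omega
  have hEa : {x | word x d m = b} ∩ avoiding a (m + d) ⊆ {x | word x d m = b} \ E := by
    rintro y ⟨hy1, hy2⟩
    refine ⟨hy1, fun hyE => ?_⟩
    exact hy2 (t - j) (by omega) (word_eq_append_iff.1 (word_eq_append_iff.1 hyE).1).1
  calc _ ≤ P.real ({x | word x d m = b} \ E) := measureReal_mono hEa
    _ = cylProb P b - cylProb P (a ++ ξ ++ b) := by
        rw [measureReal_sdiff hEsub (measurableSet_word_eq _ _ _), hPb, measureReal_word_eq hP]
    _ ≤ _ := by linarith

/-- Iterating over `J` blocks bounds the probability of avoidance by (1 - u)^J ≤ e^{-uJ}, where u =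
e^{-κ} P[a]; then z e^{-z} ≤ 1 with z = uJ. -/
lemma SelectivelyDecoupledAt.mul_measureReal_avoiding_le (hP : MeasurePreserving shift P P)
    {t : ℕ} {κ : ℝ} (hκ : 0 ≤ κ) {a : List A} (h : SelectivelyDecoupledAt P a.length t κ)
    (ha : 0 < cylProb P a) {J N : ℕ} (hN : 1 + J * (a.length + t) ≤ N) :
    Real.exp (-κ) * cylProb P a * J * P.real (avoiding a N) ≤ 1 := by
  set u := Real.exp (-κ) * cylProb P a with hu
  have hu0 : 0 < u := mul_pos (Real.exp_pos _) ha
  have hu1 : u ≤ 1 := by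
    have h1 : Real.exp (-κ) ≤ 1 := Real.exp_le_one_iff.2 (by linarith)
    exact mul_le_one₀ h1 (cylProb_nonneg P _) (cylProb_le_one P _)
  have hpow : ∀ J : ℕ, P.real (avoiding a (1 + J * (a.length + t))) ≤ (1 - u) ^ J := by
    intro J
    induction J with
    | zero => simp
    | succ J ih =>
      have e : 1 + (J + 1) * (a.length + t) = 1 + J * (a.length + t) + (a.length + t) := by ring
      rw [e, pow_succ']
      refine (h.measureReal_avoiding_add_le hP hκ ha (by omega)).trans ?_
      exact mul_le_mul_of_nonneg_left ih (by linarith)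
  have h1 : P.real (avoiding a N) ≤ Real.exp (-(u * J)) := by
    refine ((measureReal_mono (avoiding_anti a hN)).trans (hpow J)).trans ?_
    rw [mul_comm u, ← mul_neg, Real.exp_nat_mul]
    refine pow_le_pow_left₀ (by linarith) ?_ J
    linarith [Real.add_one_le_exp (-u)]
  have h2 : u * J ≤ Real.exp (u * J) := by linarith [Real.add_one_le_exp (u * J)]
  calc u * J * P.real (avoiding a N) ≤ Real.exp (u * J) * Real.exp (-(u * J)) :=
        mul_le_mul h2 h1 measureReal_nonneg (Real.exp_pos _).le
    _ = 1 := by rw [← Real.exp_add, add_neg_cancel, Real.exp_zero]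

lemma SelectivelyLowerDecoupled.ae_occurs (hP : MeasurePreserving shift P P)
    (hSLD : SelectivelyLowerDecoupled P) :
    ∀ᵐ x ∂P, ∀ a : List A, 0 < cylProb P a → ∃ r, word x r a.length = a := by
  obtain ⟨κ, τ, ⟨hκ, -, -⟩, hdec⟩ := hSLD
  rw [ae_all_iff]
  intro a
  by_cases ha : 0 < cylProb P a
  swap
  · simp [ha]
  rcases Nat.eq_zero_or_pos a.length with h0 | h0
  · exact Eventually.of_forall fun x _ => ⟨0, by rw [List.eq_nil_of_length_eq_zero h0]; simp [word]⟩
  have hd : SelectivelyDecoupledAt P a.length (τ a.length) (κ a.length) := hdec _ h0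
  have hle : ∀ J : ℕ, Real.exp (-κ a.length) * cylProb P a * J *
      P.real {x | ∀ r, word x r a.length ≠ a} ≤ 1 := fun J => by
    refine le_trans ?_ (hd.mul_measureReal_avoiding_le hP (hκ _) ha (J := J) le_rfl)
    refine mul_le_mul_of_nonneg_left (measureReal_mono fun x hx r _ => hx r) ?_
    exact mul_nonneg (mul_pos (Real.exp_pos _) ha).le (Nat.cast_nonneg J)
  have hz : P.real {x | ∀ r, word x r a.length ≠ a} = 0 := by
    by_contra hne
    have hpos : 0 < Real.exp (-κ a.length) * cylProb P a *
        P.real {x | ∀ r, word x r a.length ≠ a} :=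
      mul_pos (mul_pos (Real.exp_pos _) ha) (measureReal_nonneg.lt_of_ne' hne)
    obtain ⟨J, hJ⟩ := exists_nat_gt (1 / (Real.exp (-κ a.length) * cylProb P a *
        P.real {x | ∀ r, word x r a.length ≠ a}))
    rw [div_lt_iff₀ hpos] at hJ
    linarith [hle J]
  rw [measureReal_eq_zero_iff] at hz
  refine measure_mono_null (fun x hx => ?_) hz
  simpa [ha] using hx

lemma half_lt_log_two : (1 / 2 : ℝ) < Real.log 2 := by linarith [Real.log_two_gt_d9]

lemma exp_half_le_two_pow (k : ℕ) : Real.exp (k / 2) ≤ 2 ^ k := by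
  rw [← Real.exp_log (zero_lt_two' ℝ), ← Real.exp_nat_mul, Real.exp_le_exp,
    Real.exp_log (zero_lt_two' ℝ)]
  have : (0 : ℝ) ≤ k := Nat.cast_nonneg k
  nlinarith [half_lt_log_two]

lemma eventually_mul_add_le_exp {c : ℝ} (hc : 0 < c) (a b : ℝ) :
    ∀ᶠ k : ℕ in atTop, a * k + b ≤ Real.exp (c * k) := by
  have h1 : (fun k : ℕ => a * k + b) =o[atTop] fun k : ℕ => Real.exp (c * k) := by
    have hexp : (fun x : ℝ => x) =o[atTop] fun x => Real.exp (c * x) := by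
      simpa using isLittleO_pow_exp_pos_mul_atTop 1 hc
    have h2 : (fun k : ℕ => (k : ℝ)) =o[atTop] fun k : ℕ => Real.exp (c * k) :=
      hexp.comp_tendsto tendsto_natCast_atTop_atTop
    refine (h2.const_mul_left a).add ?_
    refine (isLittleO_const_left.2 (Or.inr ?_))
    refine tendsto_norm_atTop_atTop.comp (Real.tendsto_exp_atTop.comp ?_)
    exact tendsto_natCast_atTop_atTop.const_mul_atTop hc
  filter_upwards [h1.def zero_lt_one] with k hk
  rw [one_mul, Real.norm_of_nonneg (Real.exp_pos _).le] at hk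
  exact (Real.le_norm_self _).trans hk

/-- Words of length about k/K have only subexponential decoupling constants, so waiting times are
about 1/P[a] ≤ e^{k/4}, well below 2^k ≥ e^{k/2}. The room left pays for the union over all words of
that length once K is large. -/
lemma SelectivelyLowerDecoupled.ae_eventually_occurs (hP : MeasurePreserving shift P P)
    (hSLD : SelectivelyLowerDecoupled P) :
    ∃ K₀ : ℕ, 1 ≤ K₀ ∧ ∀ K, K₀ ≤ K → ∀ᵐ x ∂P, ∀ᶠ k : ℕ in atTop, ∀ a : List A,
      a.length = k / K → Real.exp (-(k / 4)) ≤ cylProb P a →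
        ∃ r, r + a.length ≤ 2 ^ k ∧ word x r a.length = a := by
  obtain ⟨κ, τ, ⟨hκ, hκo, hτo⟩, hdec⟩ := hSLD
  have hA : Nonempty A := by
    obtain ⟨y⟩ := nonempty_of_isProbabilityMeasure P
    exact ⟨y 0⟩
  have hcard : (1 : ℝ) ≤ Fintype.card A := by exact_mod_cast Fintype.card_pos
  have hlog : 0 ≤ Real.log (Fintype.card A) := Real.log_nonneg hcard
  obtain ⟨C, hC0, hC⟩ := exists_le_mul_add_of_isLittleO hκo zero_lt_one
  obtain ⟨C', hC0', hC'⟩ := exists_le_mul_add_of_isLittleO hτo zero_lt_one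
  -- With l = k/K, the number |A|^l of words and the bound κ(l) ≤ l + C together cost e^{k/16 + C}.
  -- The block length costs another e^{k/16} and 1/P[a] costs e^{k/4}; against e^{-k/2} this leaves
  -- e^{C - k/8}.
  obtain ⟨K₀, hK₀⟩ := exists_nat_ge (16 * (Real.log (Fintype.card A) + 1))
  have hK₀1 : 1 ≤ K₀ := by
    have : (1 : ℝ) ≤ K₀ := by linarith
    exact_mod_cast this
  refine ⟨K₀, hK₀1, fun K hK => ?_⟩
  have hK1 : 1 ≤ K := hK₀1.trans hK
  have hKpos : (0 : ℝ) < K := by exact_mod_cast hK1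
  have hKlog : 16 * (Real.log (Fintype.card A) + 1) ≤ K := hK₀.trans (by exact_mod_cast hK)
  have hsum : Summable fun k : ℕ => 2 * Real.exp C * Real.exp (-(1 / 8)) ^ k :=
    (summable_geometric_of_lt_one (Real.exp_pos _).le
      (Real.exp_lt_one_iff.2 (by norm_num))).mul_left _
  have hBC := ae_eventually_notMem_of_summable (μ := P)
    (s := fun k => ⋃ v ∈ Finset.univ.filter (fun v : Fin (k / K) → A =>
      Real.exp (-(k / 4)) ≤ cylProb P (List.ofFn v)), avoiding (List.ofFn v) (2 ^ k)) hsum ?_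
  · filter_upwards [hBC] with x hx
    filter_upwards [hx] with k hk a hak haP
    by_contra hc
    push Not at hc
    refine hk ?_
    obtain ⟨v, rfl⟩ : ∃ v : Fin (k / K) → A, a = List.ofFn v :=
      ⟨fun i => a.get ⟨i, by omega⟩, by apply List.ext_getElem <;> simp [hak]⟩
    simp only [Finset.mem_filter, Finset.mem_univ, true_and, Set.mem_iUnion]
    exact ⟨v, haP, hc⟩
  · filter_upwards [eventually_ge_atTop K,
      eventually_mul_add_le_exp (show (0 : ℝ) < 1 / 16 by norm_num) 2 C',
      eventually_mul_add_le_exp (show (0 : ℝ) < 1 / 2 by norm_num) 4 (2 * C' + 2)]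
      with k hkK hd1 hd2
    set l := k / K with hl
    have hl1 : 1 ≤ l := (Nat.one_le_div_iff (by omega)).2 hkK
    have hlk : (l : ℝ) * K ≤ k := by exact_mod_cast Nat.div_mul_le_self k K
    have hlk' : (l : ℝ) ≤ k := by exact_mod_cast Nat.div_le_self k K
    have hl0 : (0 : ℝ) ≤ l := Nat.cast_nonneg l
    set d := l + τ l with hdd
    have hdle : (d : ℝ) ≤ 2 * k + C' := by
      rw [hdd]; push_cast; linarith [hC' l]
    have hd0 : 0 < d := by omega
    set J := (2 ^ k - 1) / d with hJ
    have hpow2 := exp_half_le_two_pow k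
    have h2k : 1 ≤ 2 ^ k := Nat.one_le_two_pow
    have hJd : 1 + J * d ≤ 2 ^ k := by
      have := Nat.div_mul_le_self (2 ^ k - 1) d
      rw [← hJ] at this
      omega
    have hJd2 : (2 : ℝ) ^ k / 2 ≤ J * d := by
      have h1 : 2 ^ k - 1 < J * d + d := by
        have := Nat.lt_div_mul_add (a := 2 ^ k - 1) hd0
        rw [← hJ] at this
        exact this
      have h2 : 2 ^ k ≤ J * d + d := by omega
      have h3 : (2 : ℝ) ^ k ≤ J * d + d := by exact_mod_cast h2
      have h4 : Real.exp (1 / 2 * k) = Real.exp (k / 2) := by congr 1; ring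
      linarith
    have hbound : ∀ v : Fin l → A, Real.exp (-(k / 4)) ≤ cylProb P (List.ofFn v) →
        P.real (avoiding (List.ofFn v) (2 ^ k)) ≤
          2 * Real.exp (C + l + k / 16 + k / 4 - k / 2) := by
      intro v hv
      have hpos := (Real.exp_pos _).trans_le hv
      have hdv : SelectivelyDecoupledAt P (List.ofFn v).length (τ l) (κ l) := by
        rw [List.length_ofFn]; exact hdec l hl1
      have h := hdv.mul_measureReal_avoiding_le hP (hκ l) hpos (J := J) (N := 2 ^ k)
        (by rw [List.length_ofFn]; exact hJd)
      set p := P.real (avoiding (List.ofFn v) (2 ^ k)) with hp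
      have hp0 : 0 ≤ p := measureReal_nonneg
      have hd1' : (d : ℝ) ≤ Real.exp (k / 16) := by
        refine hdle.trans (hd1.trans_eq ?_)
        congr 1; ring
      have hd0' : (0 : ℝ) < d := by exact_mod_cast hd0
      have hX : Real.exp (k / 2) * p ≤ 2 * (d * Real.exp (κ l + k / 4)) := by
        have a1 : Real.exp (-κ l) * Real.exp (-(k / 4)) * J * p ≤ 1 := by
          refine le_trans ?_ h
          gcongr
        have a2 : (J : ℝ) * p ≤ Real.exp (κ l + k / 4) := by
          have : Real.exp (-κ l) * Real.exp (-(k / 4)) * Real.exp (κ l + k / 4) = 1 := by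
            rw [← Real.exp_add, ← Real.exp_add, ← Real.exp_zero]
            congr 1; ring
          calc (J : ℝ) * p = (Real.exp (-κ l) * Real.exp (-(k / 4)) * J * p) *
                Real.exp (κ l + k / 4) := by
                calc (J : ℝ) * p = (Real.exp (-κ l) * Real.exp (-(k / 4)) *
                    Real.exp (κ l + k / 4)) * (J * p) := by rw [this, one_mul]
                  _ = _ := by ring
            _ ≤ 1 * Real.exp (κ l + k / 4) :=
                mul_le_mul_of_nonneg_right a1 (Real.exp_pos _).le
            _ = _ := one_mul _
        calc Real.exp (k / 2) * p ≤ (2 * (J * d)) * p :=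
              mul_le_mul_of_nonneg_right (by linarith) hp0
          _ = 2 * (d * (J * p)) := by ring
          _ ≤ _ := by gcongr
      have hX2 : Real.exp (k / 2) * p ≤ 2 * Real.exp (k / 16 + (C + l + k / 4)) := by
        refine hX.trans ?_
        rw [Real.exp_add (k / 16)]
        gcongr
        linarith [hC l]
      calc p = Real.exp (-(k / 2)) * (Real.exp (k / 2) * p) := by
            rw [← mul_assoc, ← Real.exp_add, neg_add_cancel, Real.exp_zero, one_mul]
        _ ≤ Real.exp (-(k / 2)) * (2 * Real.exp (k / 16 + (C + l + k / 4))) := by gcongr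
        _ = 2 * (Real.exp (-(k / 2)) * Real.exp (k / 16 + (C + l + k / 4))) := by ring
        _ = _ := by
            rw [← Real.exp_add]
            congr 2; ring
    refine (measure_biUnion_finset_le _ _).trans ?_
    refine (Finset.sum_le_sum fun v hv => (ofReal_measureReal (μ := P)
      (s := avoiding (List.ofFn v) (2 ^ k))).symm.le.trans (ENNReal.ofReal_le_ofReal
        (hbound v (Finset.mem_filter.1 hv).2))).trans ?_
    rw [Finset.sum_const, nsmul_eq_mul, ← ENNReal.ofReal_natCast,
      ← ENNReal.ofReal_mul (Nat.cast_nonneg _)]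
    refine ENNReal.ofReal_le_ofReal ?_
    have hcardle : (((Finset.univ.filter (fun v : Fin l → A =>
        Real.exp (-(k / 4)) ≤ cylProb P (List.ofFn v))).card : ℕ) : ℝ) ≤
        Real.exp (l * Real.log (Fintype.card A)) := by
      rw [Real.exp_nat_mul, Real.exp_log (zero_lt_one.trans_le hcard)]
      have := Finset.card_filter_le (Finset.univ : Finset (Fin l → A)) (fun v : Fin l → A =>
        Real.exp (-(k / 4)) ≤ cylProb P (List.ofFn v))
      rw [Finset.card_univ, Fintype.card_fun, Fintype.card_fin] at this
      exact_mod_cast this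
    refine (mul_le_mul_of_nonneg_right hcardle (by positivity)).trans ?_
    rw [← Real.exp_nat_mul, mul_left_comm, mul_assoc, ← Real.exp_add, ← Real.exp_add]
    refine mul_le_mul_of_nonneg_left (Real.exp_le_exp.2 ?_) zero_le_two
    have : (l : ℝ) * (16 * (Real.log (Fintype.card A) + 1)) ≤ k :=
      (mul_le_mul_of_nonneg_left hKlog hl0).trans hlk
    linarith

end Occurrence

/-! ### Combinatorics of the modified Ziv–Merhav parsing -/

section Parsing

variable {A : Type*}

lemma waitingTime_add_le_iff {l N : ℕ} {y x : ℕ → A} :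
    waitingTime l y x + (l : ℕ∞) ≤ (N : ℕ∞) + 1 ↔ ∃ r, r + l ≤ N ∧ word x r l = word y 0 l := by
  constructor
  · intro h
    rcases Set.eq_empty_or_nonempty
      {w : ℕ∞ | ∃ r : ℕ, 1 ≤ r ∧ word x (r - 1) l = word y 0 l ∧ w = (r : ℕ∞)} with h0 | h0
    · rw [waitingTime, h0, sInf_empty, top_add, top_le_iff] at h
      exact absurd h (by exact_mod_cast ENat.natCast_ne_top (N + 1))
    · obtain ⟨r, hr1, hr2, hr3⟩ := csInf_mem h0
      refine ⟨r - 1, ?_, hr2⟩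
      rw [waitingTime, hr3] at h
      have : r + l ≤ N + 1 := by exact_mod_cast h
      omega
  · rintro ⟨r, hr, hw⟩
    have h1 : waitingTime l y x ≤ ((r + 1 : ℕ) : ℕ∞) := sInf_le ⟨r + 1, by omega, hw, rfl⟩
    refine (add_le_add_left h1 _).trans ?_
    have : r + 1 + l ≤ N + 1 := by omega
    exact_mod_cast this

lemma matchLength_eq (N : ℕ) (y x : ℕ → A) :
    matchLength N y x = max 1 (sSup {l : ℕ | 1 ≤ l ∧ ∃ r, r + l ≤ N ∧ word x r l = word y 0 l}) := by
  simp only [matchLength, waitingTime_add_le_iff]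

lemma bddAbove_matches (N : ℕ) (y x : ℕ → A) :
    BddAbove {l : ℕ | 1 ≤ l ∧ ∃ r, r + l ≤ N ∧ word x r l = word y 0 l} :=
  ⟨N, fun l ⟨_, r, hr, _⟩ => by omega⟩

lemma le_matchLength {N p r l : ℕ} {y x : ℕ → A} (hr : r + l ≤ N)
    (hw : word x r l = word y p l) : l ≤ matchLength N (shift^[p] y) x := by
  rcases Nat.eq_zero_or_pos l with rfl | hl
  · exact Nat.zero_le _
  · rw [matchLength_eq]
    refine le_max_of_le_right (le_csSup (bddAbove_matches _ _ _) ⟨hl, r, hr, ?_⟩)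
    rw [word_shift_iterate, Nat.add_zero, hw]

/-- The value 1 may be the default for the absence of any match; from 2 on the match length is
attained by a true match. -/
lemma exists_eq_of_two_le_matchLength {N p : ℕ} {y x : ℕ → A}
    (h : 2 ≤ matchLength N (shift^[p] y) x) :
    ∃ r, r + matchLength N (shift^[p] y) x ≤ N ∧
      word x r (matchLength N (shift^[p] y) x) = word y p (matchLength N (shift^[p] y) x) := by
  have h0 : {l : ℕ | 1 ≤ l ∧ ∃ r, r + l ≤ N ∧ word x r l = word (shift^[p] y) 0 l}.Nonempty := by
    by_contra hne
    rw [matchLength_eq, Set.not_nonempty_iff_eq_empty.1 hne] at h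
    simp at h
  have hmem := Nat.sSup_mem h0 (bddAbove_matches _ _ _)
  have e : matchLength N (shift^[p] y) x =
      sSup {l : ℕ | 1 ≤ l ∧ ∃ r, r + l ≤ N ∧ word x r l = word (shift^[p] y) 0 l} := by
    rw [matchLength_eq]
    exact max_eq_right hmem.1
  rw [← e] at hmem
  obtain ⟨-, r, hr, hw⟩ := hmem
  exact ⟨r, hr, by rw [hw, word_shift_iterate, Nat.add_zero]⟩

variable (N : ℕ) (y x : ℕ → A)

lemma parseEnd_le (i : ℕ) : parseEnd N y x i ≤ N := by
  cases i with
  | zero => exact Nat.zero_le _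
  | succ i => exact min_le_left _ _

lemma parseEnd_succ (i : ℕ) : parseEnd N y x (i + 1) =
    min N (parseEnd N y x i + matchLength N (shift^[parseEnd N y x i] y) x + 1) := rfl

lemma parseEnd_monotone : Monotone (parseEnd N y x) := by
  refine monotone_nat_of_le_succ fun i => ?_
  rw [parseEnd_succ]
  exact le_min (parseEnd_le N y x i) (by omega)

lemma parseEnd_parseCount : parseEnd N y x (parseCount N y x) = N := by
  have h : ∀ i, min N i ≤ parseEnd N y x i := fun i => by
    induction i with
    | zero => simp
    | succ i ih =>
      rw [parseEnd_succ]
      omega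
  exact Nat.sInf_mem (s := {i : ℕ | parseEnd N y x i = N})
    ⟨N, le_antisymm (parseEnd_le N y x N) (by simpa using h N)⟩

variable {N y x}

lemma parseEnd_lt {i : ℕ} (hi : i < parseCount N y x) : parseEnd N y x i < N :=
  (parseEnd_le N y x i).lt_of_ne fun h => Nat.notMem_of_lt_sInf hi h

/-- Only the last word can be truncated at `N`. The condition `i + 1 < parseCount N y x` thus
singles out the complete words. -/
lemma parseEnd_succ_eq {i : ℕ} (hi : i + 1 < parseCount N y x) : parseEnd N y x (i + 1) =
    parseEnd N y x i + matchLength N (shift^[parseEnd N y x i] y) x + 1 := by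
  have h := parseEnd_lt hi
  rw [parseEnd_succ] at h ⊢
  omega

variable (N y x)

/-- The length of the word with number `i + 1` of the parsing. -/
noncomputable def parseLength (i : ℕ) : ℕ := parseEnd N y x (i + 1) - parseEnd N y x i

lemma parseEnd_add_parseLength (i : ℕ) :
    parseEnd N y x i + parseLength N y x i = parseEnd N y x (i + 1) :=
  Nat.add_sub_cancel' (parseEnd_monotone N y x (Nat.le_succ i))

lemma parsedWord_eq (i : ℕ) :
    parsedWord N y x i = word y (parseEnd N y x i) (parseLength N y x i) := rfl

lemma trimmedWord_eq (i : ℕ) :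
    trimmedWord N y x i = word y (parseEnd N y x i) (parseLength N y x i - 1) := by
  rw [trimmedWord, parsedWord_eq, dropLast_word]

lemma sum_parseLength (c : ℕ) :
    ∑ i ∈ Finset.range c, parseLength N y x i = parseEnd N y x c := by
  induction c with
  | zero => rfl
  | succ c ih => rw [Finset.sum_range_succ, ih, parseEnd_add_parseLength]

variable {N y x}

lemma parseLength_eq {i : ℕ} (hi : i + 1 < parseCount N y x) :
    parseLength N y x i = matchLength N (shift^[parseEnd N y x i] y) x + 1 := by
  rw [parseLength, parseEnd_succ_eq hi]
  omega

lemma lt_parseLength {i n : ℕ} (hi : i + 1 < parseCount N y x)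
    (h : ∀ p, ∃ r, r + n ≤ N ∧ word x r n = word y p n) : n < parseLength N y x i := by
  rw [parseLength_eq hi]
  obtain ⟨r, hr, hw⟩ := h (parseEnd N y x i)
  exact Nat.lt_succ_of_le (le_matchLength hr hw)

/-- A complete word of the parsing does not occur in `x₁ … x_N`. -/
lemma word_ne_of_parseLength_le {i n r : ℕ} (hi : i + 1 < parseCount N y x)
    (hn : parseLength N y x i ≤ n) (hr : r + n ≤ N) :
    word x r n ≠ word y (parseEnd N y x i) n := by
  intro hw
  have := le_matchLength hr hw
  rw [parseLength_eq hi] at hn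
  omega

/-- The trimmed words of the parsing of length at least two occur in `x₁ … x_N`. -/
lemma exists_word_eq_of_lt_parseLength {i n : ℕ} (hi : i + 1 < parseCount N y x)
    (h2 : 2 ≤ n) (hn : n < parseLength N y x i) :
    ∃ r, r + n ≤ N ∧ word x r n = word y (parseEnd N y x i) n := by
  rw [parseLength_eq hi] at hn
  obtain ⟨r, hr, hw⟩ := exists_eq_of_two_le_matchLength (N := N) (p := parseEnd N y x i) (y := y)
    (x := x) (by omega)
  refine ⟨r, by omega, ?_⟩
  rw [word_eq_word_iff] at hw ⊢
  exact fun j hj => hw j (by omega)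

end Parsing

/-! ### The lower bound for the trimmed words -/

section LowerBound

variable {A : Type*} [Fintype A] [MeasurableSpace A] [MeasurableSingletonClass A]
variable {P Q : Measure (ℕ → A)} [IsProbabilityMeasure P] [IsProbabilityMeasure Q]

lemma ae_prod_word_pos (hP : MeasurePreserving shift P P) (hQ : MeasurePreserving shift Q Q)
    (hsupp : seqSupport Q ⊆ seqSupport P) :
    ∀ᵐ p : (ℕ → A) × (ℕ → A) ∂(P.prod Q), ∀ s l, 0 < cylProb P (word p.2 s l) :=
  Measure.quasiMeasurePreserving_snd.ae (ae_cylProb_word_pos_of_subset hP hQ hsupp)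

/-- There are finitely many words of length `n`, and almost surely each one positive for `P` occurs
in the first text. This forces complete parsed words to become arbitrarily long. -/
lemma ae_prod_eventually_occurs (hP : MeasurePreserving shift P P)
    (hQ : MeasurePreserving shift Q Q) (hsupp : seqSupport Q ⊆ seqSupport P)
    (hSLD : SelectivelyLowerDecoupled P) :
    ∀ᵐ p : (ℕ → A) × (ℕ → A) ∂(P.prod Q), ∀ n, ∀ᶠ N : ℕ in atTop, ∀ s,
      ∃ r, r + n ≤ N ∧ word p.1 r n = word p.2 s n := by
  filter_upwards [ae_prod_word_pos hP hQ hsupp,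
    Measure.quasiMeasurePreserving_fst.ae (hSLD.ae_occurs hP)] with p hp hx n
  have h : ∀ v : Fin n → A, ∃ r, 0 < cylProb P (List.ofFn v) → word p.1 r n = List.ofFn v := by
    intro v
    by_cases hv : 0 < cylProb P (List.ofFn v)
    · obtain ⟨r, hr⟩ := hx _ hv
      exact ⟨r, fun _ => by simpa using hr⟩
    · exact ⟨0, fun h => absurd h hv⟩
  choose r hr using h
  filter_upwards [eventually_ge_atTop (Finset.univ.sup r + n)] with N hN s
  refine ⟨r (fun i => p.2 (s + i)), ?_, ?_⟩
  · have := Finset.le_sup (f := r) (Finset.mem_univ (fun i : Fin n => p.2 (s + i)))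
    omega
  · rw [word_eq_ofFn p.2]
    refine hr _ ?_
    rw [← word_eq_ofFn]
    exact hp s n

lemma neg_log_cylProb_nonneg (a : List A) : 0 ≤ -Real.log (cylProb P a) :=
  neg_nonneg.2 (Real.log_nonpos (cylProb_nonneg P a) (cylProb_le_one P a))

lemma lintegral_cylProb_rpow_eventually_le (hP : MeasurePreserving shift P P)
    (hQ : MeasurePreserving shift Q Q) (hsupp : seqSupport Q ⊆ seqSupport P) {α r : ℝ}
    (h : pressure P Q α < (r : EReal)) :
    ∀ᶠ n : ℕ in atTop, ∀ s, ∫⁻ y, ENNReal.ofReal (cylProb P (word y s n) ^ (-α)) ∂Q ≤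
      ENNReal.ofReal (Real.exp (r * n)) := by
  filter_upwards [eventually_pressureSum_le h] with n hn s
  rw [lintegral_cylProb_rpow hP hQ hsupp]
  exact ENNReal.ofReal_le_ofReal hn

/-- Cutting off the last K-th part of a long word leaves a word whose required gap fits into the
part cut off. -/
lemma eventually_div_separated {τ : ℕ → ℕ}
    (hτ : (fun n => (τ n : ℝ)) =o[atTop] fun n : ℕ => (n : ℝ)) (m : ℕ) {K : ℕ} (hK : 2 ≤ K) :
    ∀ᶠ n : ℕ in atTop, m < n - n / K ∧ τ (n - n / K) ≤ n / K := by
  have hK0 : (0 : ℝ) < K := by exact_mod_cast (by omega : 0 < K)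
  have hhalf : ∀ n : ℕ, n / 2 ≤ n - n / K := fun n => by
    have : n / K ≤ n / 2 := Nat.div_le_div_left hK (by norm_num)
    omega
  have htend : Tendsto (fun n : ℕ => n - n / K) atTop atTop :=
    tendsto_atTop_mono hhalf (Nat.tendsto_div_const_atTop (by norm_num))
  filter_upwards [htend.eventually (eventually_le_mul_of_isLittleO hτ
      (ε := 1 / (2 * K)) (by positivity)),
    htend.eventually (eventually_gt_atTop m), eventually_ge_atTop (2 * K)] with n h1 h2 h3
  refine ⟨h2, ?_⟩
  have h4 : ((n - n / K : ℕ) : ℝ) ≤ n := by exact_mod_cast Nat.sub_le _ _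
  have h5 : (τ (n - n / K) : ℝ) ≤ n / (2 * K) :=
    h1.trans (by rw [one_div, inv_mul_eq_div]; gcongr)
  have h6 : τ (n - n / K) * (2 * K) ≤ n := by
    rw [le_div_iff₀ (by positivity)] at h5
    exact_mod_cast h5
  rw [Nat.le_div_iff_mul_le (by omega)]
  nlinarith

lemma parseCount_lt {N : ℕ} {y x : ℕ → A} (hN : 2 < N)
    (h : ∀ i, i + 1 < parseCount N y x → 1 < parseLength N y x i) : parseCount N y x < N := by
  have h1 : ∑ i ∈ Finset.range (parseCount N y x - 1), 2 ≤ N := by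
    refine le_trans (Finset.sum_le_sum fun i hi => ?_)
      ((sum_parseLength N y x (parseCount N y x - 1)).trans_le (parseEnd_le N y x _))
    rw [Finset.mem_range] at hi
    exact h i (by omega)
  simp only [Finset.sum_const, Finset.card_range, smul_eq_mul] at h1
  omega

lemma ae_eventually_mul_le_sum_trimmedWord (hP : MeasurePreserving shift P P)
    (hQ : MeasurePreserving shift Q Q) (hsupp : seqSupport Q ⊆ seqSupport P)
    (hSLD : SelectivelyLowerDecoupled P) (hUD : UpperDecoupled Q) {R' : ℝ} (hR'0 : 0 < R')
    (hR' : (R' : EReal) < sSup (pressureSlope P Q '' Set.Iio 0)) :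
    ∀ᵐ p : (ℕ → A) × (ℕ → A) ∂(P.prod Q), ∀ᶠ N : ℕ in atTop,
      R' * N ≤ ∑ i ∈ Finset.range (parseCount N p.2 p.1),
          -Real.log (cylProb P (trimmedWord N p.2 p.1 i)) := by
  obtain ⟨R, hR'R, hR⟩ := EReal.lt_iff_exists_real_btwn.1 hR'
  replace hR'R : R' < R := by exact_mod_cast hR'R
  obtain ⟨α, hα, hpα⟩ := exists_pressure_lt_of_lt_sSup hR
  obtain ⟨τ, hτ, hbound⟩ := hUD.ae_eventually_sum_log_le hQ
  set δ := R - R' with hδ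
  have hδ0 : 0 < δ := by linarith
  -- The margin `δ` is spent in quarters: two on the error terms of the uniform bound (proportional
  -- to the lengths and to `N`), one on the cuts through `R / K ≤ δ / 4`, and one on the last word
  -- through `hN`.
  obtain ⟨m, hm⟩ := hbound (fun a => cylProb P a ^ (-α)) (α * R) (-α * (δ / 4))
    (mul_pos (by linarith) (by linarith))
    ((lintegral_cylProb_rpow_eventually_le hP hQ hsupp hpα).mono fun n hn => hn 0)
  obtain ⟨K, hK⟩ := exists_nat_ge (max 2 (4 * R / δ))
  have hK2 : 2 ≤ K := by exact_mod_cast (le_max_left _ _).trans hK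
  have hK0 : (0 : ℝ) < K := by exact_mod_cast (by omega : 0 < K)
  have hRK : R / K ≤ δ / 4 := by
    have h := (le_max_right _ _).trans hK
    rw [div_le_iff₀ hδ0] at h
    rw [div_le_iff₀ hK0]
    linarith
  obtain ⟨n₁, hn₁⟩ := eventually_atTop.1 (eventually_div_separated hτ m hK2)
  filter_upwards [ae_prod_eventually_occurs hP hQ hsupp hSLD, ae_prod_word_pos hP hQ hsupp,
    Measure.quasiMeasurePreserving_snd.ae hm] with p hocc hpos hsum
  have hlin : ∀ᶠ N : ℕ in atTop, 4 * R * (n₁ + K) / δ ≤ N :=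
    tendsto_natCast_atTop_atTop.eventually_ge_atTop _
  filter_upwards [hocc (n₁ + K), hsum, hlin] with N hoccN hsumN hN
  set c := parseCount N p.2 p.1 with hc
  set L := parseEnd N p.2 p.1 with hL
  set n := parseLength N p.2 p.1 with hn
  have hLn : ∀ i, L i + n i = L (i + 1) := parseEnd_add_parseLength N p.2 p.1
  have hlong : ∀ i, i + 1 < c → n₁ + K < n i := fun i hi => lt_parseLength hi hoccN
  set I := (Finset.range c).filter (fun i => n₁ + K ≤ n i) with hI
  have hIeq : (Finset.range c).filter (· ∈ I) = I := by
    ext i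
    simp only [hI, Finset.mem_filter]
    tauto
  have hmemI : ∀ i ∈ I, n₁ + K ≤ n i := fun i hi => (Finset.mem_filter.1 hi).2
  have key := hsumN c I L (fun i => n i - n i / K)
    (fun i _ => parseEnd_monotone N p.2 p.1 (Nat.le_succ i)) (fun i _ hi => by
      obtain ⟨h1, h2⟩ := hn₁ (n i) (by have := hmemI i hi; omega)
      have h3 := hLn i
      have h4 : L (i + 1) ≤ N := parseEnd_le N p.2 p.1 (i + 1)
      have h5 : n i / K ≤ n i := Nat.div_le_self _ _
      exact ⟨h1, by omega, by omega, Real.rpow_pos_of_pos (hpos _ _) _⟩)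
  rw [hIeq] at key
  have hlogeq : ∀ i, Real.log (cylProb P (word p.2 (L i) (n i - n i / K)) ^ (-α)) =
      -α * Real.log (cylProb P (word p.2 (L i) (n i - n i / K))) := fun i =>
    Real.log_rpow (hpos _ _) _
  simp only [hlogeq] at key
  rw [← Finset.mul_sum] at key
  set X := ∑ i ∈ I, Real.log (cylProb P (word p.2 (L i) (n i - n i / K))) with hX
  set Λ := ∑ i ∈ I, ((n i - n i / K : ℕ) : ℝ) with hΛ
  have key2 : (R - δ / 4) * Λ - δ / 4 * N ≤ -X := by
    have : -α * ((R - δ / 4) * Λ - δ / 4 * N) ≤ -α * (-X) := by linarith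
    exact le_of_mul_le_mul_left this (by linarith)
  -- Only the last word, with index `c - 1`, can be missing from `I`.
  have hsumI : (N : ℝ) - (n₁ + K) ≤ ∑ i ∈ I, (n i : ℝ) := by
    have h1 : ∑ i ∈ Finset.range c, n i = N :=
      (sum_parseLength N p.2 p.1 c).trans (parseEnd_parseCount N p.2 p.1)
    have h2 : ∑ i ∈ Finset.range c, n i ≤ ∑ i ∈ I, n i + (n₁ + K) := by
      rw [← Finset.sum_filter_add_sum_filter_not (Finset.range c) (fun i => n₁ + K ≤ n i)]
      refine Nat.add_le_add_left ?_ _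
      calc _ ≤ ∑ i ∈ {c - 1}, (n₁ + K) := by
            refine (Finset.sum_le_sum (g := fun _ => n₁ + K) fun i hi => ?_).trans
              (Finset.sum_le_sum_of_subset ?_)
            · have := (Finset.mem_filter.1 hi).2
              omega
            · intro i hi
              obtain ⟨h3, h4⟩ := Finset.mem_filter.1 hi
              rw [Finset.mem_range] at h3
              rw [Finset.mem_singleton]
              by_contra hne
              have := hlong i (by omega)
              omega
        _ = _ := by simp
    have h3 : (N : ℝ) ≤ ∑ i ∈ I, (n i : ℝ) + (n₁ + K) := by
      rw [h1] at h2
      exact_mod_cast h2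
    linarith
  have hΛ1 : (1 - 1 / K) * ∑ i ∈ I, (n i : ℝ) ≤ Λ := by
    rw [hΛ, Finset.mul_sum]
    refine Finset.sum_le_sum fun i _ => ?_
    rw [Nat.cast_sub (Nat.div_le_self _ _)]
    have : ((n i / K : ℕ) : ℝ) ≤ n i / K := Nat.cast_div_le
    rw [sub_mul, one_mul, one_div, inv_mul_eq_div]
    linarith
  have hY : -X ≤ ∑ i ∈ Finset.range c, -Real.log (cylProb P (trimmedWord N p.2 p.1 i)) := by
    rw [hX, ← Finset.sum_neg_distrib]
    refine (Finset.sum_le_sum fun i hi => ?_).trans (Finset.sum_le_sum_of_subset_of_nonneg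
      (Finset.filter_subset _ _) fun i _ _ => neg_log_cylProb_nonneg _)
    rw [trimmedWord_eq, neg_le_neg_iff]
    -- At least one letter is cut off, so the shortened word is a prefix of the trimmed word.
    have h1 : 1 ≤ n i / K := (Nat.one_le_div_iff (by omega)).2 (by have := hmemI i hi; omega)
    have h2 : n i - n i / K ≤ n i - 1 := by omega
    exact Real.log_le_log (hpos _ _) (cylProb_word_anti P p.2 _ h2)
  refine le_trans ?_ (key2.trans hY)
  have hRδ : 0 ≤ R - δ / 4 := by linarith
  have hK1 : (0 : ℝ) ≤ 1 - 1 / K := by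
    rw [sub_nonneg, div_le_one hK0]
    exact_mod_cast (by omega : 1 ≤ K)
  have h1 : (R - δ / 4) * ((1 - 1 / K) * (N - (n₁ + K))) ≤ (R - δ / 4) * Λ :=
    mul_le_mul_of_nonneg_left ((mul_le_mul_of_nonneg_left hsumI hK1).trans hΛ1) hRδ
  rw [div_le_iff₀ hδ0] at hN
  have hnK : (0 : ℝ) ≤ (n₁ : ℝ) + K := by positivity
  have hR0 : 0 < R := by linarith
  have h2 : (R - δ / 2) * N - R * (n₁ + K) ≤ (R - δ / 4) * ((1 - 1 / K) * (N - (n₁ + K))) := by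
    have e1 : R - δ / 2 ≤ (R - δ / 4) * (1 - 1 / K) := by
      have : (R - δ / 4) * (1 - 1 / K) = R - δ / 4 - R / K + δ / 4 * (1 / K) := by ring
      have h3 : 0 ≤ δ / 4 * (1 / (K : ℝ)) := by positivity
      linarith
    have e2 : (R - δ / 4) * (1 - 1 / K) ≤ R := by
      have h3 : (0 : ℝ) ≤ 1 / K := by positivity
      calc (R - δ / 4) * (1 - 1 / K) ≤ (R - δ / 4) * 1 :=
            mul_le_mul_of_nonneg_left (by linarith) hRδ
        _ ≤ R := by linarith
    have e3 := mul_le_mul_of_nonneg_right e1 (Nat.cast_nonneg (α := ℝ) N)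
    have e4 := mul_le_mul_of_nonneg_right e2 hnK
    calc _ ≤ (R - δ / 4) * (1 - 1 / K) * N - (R - δ / 4) * (1 - 1 / K) * (n₁ + K) := by linarith
      _ = _ := by ring
  have h4 : R' = R - δ := by rw [hδ]; ring
  rw [h4]
  nlinarith

theorem ae_eventually_le_average_trimmedWord (hP : MeasurePreserving shift P P)
    (hQ : MeasurePreserving shift Q Q) (hsupp : seqSupport Q ⊆ seqSupport P)
    (hSLD : SelectivelyLowerDecoupled P) (hUD : UpperDecoupled Q) {R : ℝ}
    (hR : (R : EReal) < sSup (pressureSlope P Q '' Set.Iio 0)) :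
    ∀ᵐ p : (ℕ → A) × (ℕ → A) ∂(P.prod Q), ∀ᶠ N : ℕ in atTop,
      R ≤ 1 / ((N : ℝ) - (parseCount N p.2 p.1 : ℝ)) *
        ∑ i ∈ Finset.range (parseCount N p.2 p.1),
          -Real.log (cylProb P (trimmedWord N p.2 p.1 i)) := by
  have hcount : ∀ᵐ p : (ℕ → A) × (ℕ → A) ∂(P.prod Q), ∀ᶠ N : ℕ in atTop,
      parseCount N p.2 p.1 < N := by
    filter_upwards [ae_prod_eventually_occurs hP hQ hsupp hSLD] with p hocc
    filter_upwards [hocc 1, eventually_gt_atTop 2] with N h1 hN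
    exact parseCount_lt hN fun i hi => lt_parseLength hi h1
  rcases le_or_gt R 0 with hR0 | hR0
  -- For `R ≤ 0` the nonnegativity of the terms suffices, once the denominator is known to be
  -- positive.
  · filter_upwards [hcount] with p hp
    filter_upwards [hp] with N hN
    have h1 : (parseCount N p.2 p.1 : ℝ) < N := by exact_mod_cast hN
    refine hR0.trans (mul_nonneg (one_div_nonneg.2 (by linarith)) ?_)
    exact Finset.sum_nonneg fun i _ => neg_log_cylProb_nonneg _
  · filter_upwards [hcount, ae_eventually_mul_le_sum_trimmedWord hP hQ hsupp hSLD hUD hR0 hR]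
      with p hp hp2
    filter_upwards [hp, hp2] with N hN hN2
    have h1 : (parseCount N p.2 p.1 : ℝ) < N := by exact_mod_cast hN
    rw [one_div, inv_mul_eq_div, le_div_iff₀ (by linarith)]
    refine le_trans (mul_le_mul_of_nonneg_left ?_ hR0.le) hN2
    linarith [(Nat.cast_nonneg (parseCount N p.2 p.1) : (0 : ℝ) ≤ _)]

end LowerBound

/-! ### Almost sure estimates on dyadic scales -/

section DyadicEvents

variable {A : Type*} [Fintype A] [MeasurableSpace A] [MeasurableSingletonClass A]
variable {P Q : Measure (ℕ → A)} [IsProbabilityMeasure P] [IsProbabilityMeasure Q]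

lemma two_pow_le_exp (k : ℕ) : (2 : ℝ) ^ k ≤ Real.exp (7 / 10 * k) := by
  rw [← Real.exp_log (zero_lt_two' ℝ), ← Real.exp_nat_mul, Real.exp_le_exp]
  have : (0 : ℝ) ≤ k := Nat.cast_nonneg k
  nlinarith [Real.log_two_lt_d9]

lemma nonneg_of_pressure_lt (hP : MeasurePreserving shift P P) (hQ : MeasurePreserving shift Q Q)
    (hsupp : seqSupport Q ⊆ seqSupport P) {t r : ℝ} (ht : 0 ≤ t)
    (h : pressure P Q t < (r : EReal)) : 0 ≤ r := by
  obtain ⟨n, hn, hn0⟩ := ((eventually_pressureSum_le h).and (eventually_gt_atTop 0)).exists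
  have h1 : 1 ≤ pressureSum P Q t n := by
    rw [← sum_cylProb_support hP hQ hsupp n, pressureSum]
    refine Finset.sum_le_sum fun v hv => le_mul_of_one_le_left (cylProb_nonneg Q _) ?_
    exact Real.one_le_rpow_of_pos_of_le_one_of_nonpos (Finset.mem_filter.1 hv).2
      (cylProb_le_one P _) (by linarith)
  have h2 : 0 ≤ r * n := Real.one_le_exp_iff.1 (h1.trans hn)
  exact nonneg_of_mul_nonneg_left h2 (by exact_mod_cast hn0)

lemma exp_le_of_rpow_lt {q t u : ℝ} (hq : 0 < q) (ht : 0 < t) (h : q ^ (-t) < Real.exp (t * u)) :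
    Real.exp (-u) ≤ q := by
  rw [Real.rpow_def_of_pos hq, Real.exp_lt_exp] at h
  have h1 : -u < Real.log q := by nlinarith
  exact ((Real.lt_log_iff_exp_lt hq).1 h1).le

lemma le_rpow_of_lt_exp {q t u : ℝ} (hq : 0 < q) (ht : 0 < t) (h : q < Real.exp (-u)) :
    Real.exp (t * u) ≤ q ^ (-t) := by
  by_contra hc
  exact absurd h (not_lt.2 (exp_le_of_rpow_lt hq ht (not_le.1 hc)))

/-- Almost surely, words of length proportional to the logarithm of the length of the text have
probabilities bounded below by a power of it. -/
lemma ae_eventually_exp_le_cylProb_word (hP : MeasurePreserving shift P P)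
    (hQ : MeasurePreserving shift Q Q) (hsupp : seqSupport Q ⊆ seqSupport P) {t r : ℝ} (ht : 0 < t)
    (h : pressure P Q t < (r : EReal)) {C : ℕ} (hC : 1 ≤ C) :
    ∃ K : ℝ, 0 ≤ K ∧ ∀ᵐ y ∂Q, ∀ᶠ k : ℕ in atTop, ∀ s < 2 ^ (k + 1),
      Real.exp (-(K * k)) ≤ cylProb P (word y s (C * k + 1)) := by
  have hr := nonneg_of_pressure_lt hP hQ hsupp ht.le h
  -- In t K = r C + 2, the term r C pays for the moment at length C k + 1 and 2 for the 2^(k+1)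
  -- starting points, leaving a summable e^{-k}.
  refine ⟨(r * C + 2) / t, by positivity, ?_⟩
  set K := (r * C + 2) / t with hK
  have htK : t * K = r * C + 2 := by rw [hK]; field_simp
  have htend : Tendsto (fun k : ℕ => C * k + 1) atTop atTop :=
    tendsto_atTop_mono (fun k => (Nat.le_mul_of_pos_left k hC).trans (Nat.le_succ _)) tendsto_id
  have hBC := ae_eventually_notMem_of_summable (μ := Q)
    (s := fun k => ⋃ s ∈ Finset.range (2 ^ (k + 1)), {y | ENNReal.ofReal (Real.exp (t * (K * k))) ≤
      ENNReal.ofReal (cylProb P (word y s (C * k + 1)) ^ (-t))})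
    (b := fun k => 2 * Real.exp r * Real.exp (-1) ^ k)
    ((summable_geometric_of_lt_one (Real.exp_pos _).le
      (Real.exp_lt_one_iff.2 (by norm_num))).mul_left _) ?_
  · filter_upwards [hBC, ae_cylProb_word_pos_of_subset hP hQ hsupp] with y hy hpos
    filter_upwards [hy] with k hk s hs
    simp only [Finset.mem_range, Set.mem_iUnion, not_exists, Set.mem_ofPred_eq, not_le] at hk
    exact exp_le_of_rpow_lt (hpos _ _) ht (ENNReal.ofReal_lt_ofReal_iff'.1 (hk s hs)).1
  · filter_upwards [htend.eventually (lintegral_cylProb_rpow_eventually_le hP hQ hsupp h)] with k hk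
    refine (measure_biUnion_finset_le _ _).trans ?_
    refine (Finset.sum_le_sum fun s _ => measure_ofReal_le_le (measurable_word_comp
      (fun a => ENNReal.ofReal (cylProb P a ^ (-t))) _ _) (Real.exp_pos _) (hk s)).trans ?_
    rw [Finset.sum_const, Finset.card_range, nsmul_eq_mul, ← ENNReal.ofReal_natCast,
      ← ENNReal.ofReal_mul (Nat.cast_nonneg _)]
    refine ENNReal.ofReal_le_ofReal ?_
    push_cast
    rw [← Real.exp_sub, ← Real.exp_nat_mul, pow_succ', mul_assoc, mul_assoc, ← Real.exp_add]
    refine mul_le_mul_of_nonneg_left ?_ zero_le_two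
    refine (mul_le_mul_of_nonneg_right (two_pow_le_exp k) (Real.exp_pos _).le).trans ?_
    rw [← Real.exp_add, Real.exp_le_exp, ← mul_assoc, htK]
    have : (0 : ℝ) ≤ k := Nat.cast_nonneg k
    linarith

/-- Almost surely, few of the words of a small logarithmic length are improbable. -/
lemma ae_eventually_card_improbable_le (hP : MeasurePreserving shift P P)
    (hQ : MeasurePreserving shift Q Q) (hsupp : seqSupport Q ⊆ seqSupport P) {t R : ℝ} (ht : 0 < t)
    (h : pressure P Q t < ((t * R : ℝ) : EReal)) {K : ℕ} (hK : 1 ≤ K) (hKR : 16 * R ≤ K) :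
    ∀ᵐ y ∂Q, ∀ᶠ k : ℕ in atTop, (((Finset.range (2 ^ (k + 1))).filter
      (fun s => cylProb P (word y s (k / K)) < Real.exp (-(k / 4)))).card : ℝ) ≤
        2 ^ k * Real.exp (-(t / 8 * k)) := by
  have hr := nonneg_of_pressure_lt hP hQ hsupp ht.le h
  have hR : 0 ≤ R := nonneg_of_mul_nonneg_right hr ht
  have hK0 : (0 : ℝ) < K := by exact_mod_cast hK
  have hm : ∀ n k : ℕ, Measurable fun y : ℕ → A =>
      ∑ s ∈ Finset.range (2 ^ (k + 1)), ENNReal.ofReal (cylProb P (word y s n) ^ (-t)) :=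
    fun n k => Finset.measurable_fun_sum _ fun s _ =>
      measurable_word_comp (fun a => ENNReal.ofReal (cylProb P a ^ (-t))) s n
  -- The expected sum of moments is at most 2^(k+1) e^{tk/16}, hence almost surely the sum is
  -- eventually below 2^k e^{tk/8}; each improbable word contributes at least e^{tk/4} to it.
  have hBC := ae_eventually_notMem_of_summable (μ := Q)
    (s := fun k => {y | ENNReal.ofReal (2 ^ k * Real.exp (t / 8 * k)) ≤
      ∑ s ∈ Finset.range (2 ^ (k + 1)), ENNReal.ofReal (cylProb P (word y s (k / K)) ^ (-t))})
    (b := fun k => 2 * Real.exp (-(t / 16)) ^ k)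
    ((summable_geometric_of_lt_one (Real.exp_pos _).le
      (Real.exp_lt_one_iff.2 (by linarith))).mul_left _) ?_
  · filter_upwards [hBC, ae_cylProb_word_pos_of_subset hP hQ hsupp] with y hy hpos
    filter_upwards [hy] with k hk
    set B := (Finset.range (2 ^ (k + 1))).filter
      (fun s => cylProb P (word y s (k / K)) < Real.exp (-(k / 4))) with hB
    have h1 : (B.card : ℝ) * Real.exp (t * (k / 4)) ≤
        ∑ s ∈ Finset.range (2 ^ (k + 1)), cylProb P (word y s (k / K)) ^ (-t) := by
      rw [← nsmul_eq_mul, ← Finset.sum_const]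
      refine (Finset.sum_le_sum fun s hs => ?_).trans (Finset.sum_le_sum_of_subset_of_nonneg
        (Finset.filter_subset _ _) fun s _ _ => Real.rpow_nonneg (cylProb_nonneg P _) _)
      exact le_rpow_of_lt_exp (hpos _ _) ht (Finset.mem_filter.1 hs).2
    rw [not_le, ← ENNReal.ofReal_sum_of_nonneg fun s _ =>
      Real.rpow_nonneg (cylProb_nonneg P _) _, ENNReal.ofReal_lt_ofReal_iff (by positivity)] at hk
    have h2 := (h1.trans_lt hk).le
    rw [← le_div_iff₀ (Real.exp_pos _), mul_div_assoc, ← Real.exp_sub] at h2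
    refine h2.trans_eq ?_
    congr 2
    ring
  · filter_upwards [(Nat.tendsto_div_const_atTop (by omega : K ≠ 0)).eventually
      (lintegral_cylProb_rpow_eventually_le hP hQ hsupp h)] with k hk
    refine (measure_ofReal_le_le (hm _ k) (b := 2 ^ (k + 1) * Real.exp (t * R * (k / K : ℕ)))
      (by positivity) ?_).trans (ENNReal.ofReal_le_ofReal ?_)
    · rw [lintegral_finsetSum _ fun s _ =>
        measurable_word_comp (fun a => ENNReal.ofReal (cylProb P a ^ (-t))) s (k / K)]
      refine (Finset.sum_le_sum fun s _ => hk s).trans_eq ?_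
      rw [Finset.sum_const, Finset.card_range, nsmul_eq_mul, ← ENNReal.ofReal_natCast,
        ← ENNReal.ofReal_mul (Nat.cast_nonneg _)]
      push_cast
      rfl
    · rw [div_le_iff₀ (by positivity), pow_succ', ← Real.exp_nat_mul]
      have e : 2 * Real.exp (k * -(t / 16)) * (2 ^ k * Real.exp (t / 8 * k)) =
          2 * 2 ^ k * Real.exp (t / 16 * k) := by
        have : Real.exp (k * -(t / 16)) * Real.exp (t / 8 * k) = Real.exp (t / 16 * k) := by
          rw [← Real.exp_add]; congr 1; ring
        rw [← this]; ring
      rw [e]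
      gcongr 2 * 2 ^ k * Real.exp ?_
      have h1 : ((k / K : ℕ) : ℝ) ≤ k / K := Nat.cast_div_le
      have h2 : R * (k / K) ≤ k / 16 := by
        rw [mul_div_assoc', div_le_iff₀ hK0]
        have : (0 : ℝ) ≤ k := Nat.cast_nonneg k
        nlinarith
      calc t * R * ((k / K : ℕ) : ℝ) ≤ t * R * (k / K) := by gcongr
        _ = t * (R * (k / K)) := by ring
        _ ≤ t * (k / 16) := by gcongr
        _ = _ := by ring

/-- By independence a match has probability ∑ P[v] Q[v], which is the pressure sum at `α = -1`. This
is where nondegeneracy enters. -/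
lemma measure_prod_word_eq_le (hP : MeasurePreserving shift P P)
    (hQ : MeasurePreserving shift Q Q) (r s n : ℕ) :
    P.prod Q {p : (ℕ → A) × (ℕ → A) | word p.1 r n = word p.2 s n} ≤
      ENNReal.ofReal (pressureSum P Q (-1) n) := by
  have hsub : {p : (ℕ → A) × (ℕ → A) | word p.1 r n = word p.2 s n} ⊆
      ⋃ v ∈ (Finset.univ : Finset (Fin n → A)),
        {x | word x r n = List.ofFn v} ×ˢ {y | word y s n = List.ofFn v} := by
    rintro ⟨x, y⟩ hxy
    simp only [Finset.mem_univ, Set.iUnion_true, Set.mem_iUnion]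
    refine ⟨fun i : Fin n => y (s + i), ?_, word_eq_ofFn y s n⟩
    rw [Set.mem_ofPred_eq, ← word_eq_ofFn]
    exact hxy
  refine (measure_mono hsub).trans ((measure_biUnion_finset_le _ _).trans ?_)
  rw [pressureSum, Finset.sum_filter, ENNReal.ofReal_sum_of_nonneg]
  · refine Finset.sum_le_sum fun v _ => ?_
    have h1 := measure_word_eq hP r (List.ofFn v)
    have h2 := measure_word_eq hQ s (List.ofFn v)
    rw [List.length_ofFn] at h1 h2
    rw [Measure.prod_prod, h1, h2, ← ofReal_cylProb, ← ofReal_cylProb,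
      ← ENNReal.ofReal_mul (cylProb_nonneg P _)]
    split_ifs with h
    · rw [neg_neg, Real.rpow_one]
    · have h0 : cylProb P (List.ofFn v) = 0 := le_antisymm (not_lt.1 h) (cylProb_nonneg P _)
      simp [h0]
  · intro v _
    split_ifs
    · exact mul_nonneg (Real.rpow_nonneg (cylProb_nonneg P _) _) (cylProb_nonneg Q _)
    · exact le_rfl

/-- Almost surely, matches between the two texts are at most logarithmically long. -/
lemma Nondegenerate.ae_eventually_word_ne (hP : MeasurePreserving shift P P)
    (hQ : MeasurePreserving shift Q Q) (hND : Nondegenerate P Q) :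
    ∃ C : ℕ, 1 ≤ C ∧ ∀ᵐ p : (ℕ → A) × (ℕ → A) ∂(P.prod Q), ∀ᶠ k : ℕ in atTop,
      ∀ r < 2 ^ (k + 1), ∀ s < 2 ^ (k + 1), word p.1 r (C * k) ≠ word p.2 s (C * k) := by
  obtain ⟨d, hd, hd0⟩ := EReal.lt_iff_exists_real_btwn.1 hND
  replace hd0 : d < 0 := by exact_mod_cast hd0
  -- There are 4^(k+1) ≤ 4 e^{1.4 k} pairs of positions, beaten by e^{dCk} ≤ e^{-3k}.
  obtain ⟨C, hC⟩ := exists_nat_ge (max 1 (3 / (-d)))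
  have hC1 : 1 ≤ C := by exact_mod_cast (le_max_left _ _).trans hC
  have hdC : d * C ≤ -3 := by
    have h := (le_max_right _ _).trans hC
    rw [div_le_iff₀ (by linarith)] at h
    linarith
  refine ⟨C, hC1, ?_⟩
  have htend : Tendsto (fun k : ℕ => C * k) atTop atTop :=
    tendsto_atTop_mono (fun k => Nat.le_mul_of_pos_left k hC1) tendsto_id
  have hBC := ae_eventually_notMem_of_summable (μ := P.prod Q)
    (s := fun k => ⋃ r ∈ Finset.range (2 ^ (k + 1)), ⋃ s ∈ Finset.range (2 ^ (k + 1)),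
      {p : (ℕ → A) × (ℕ → A) | word p.1 r (C * k) = word p.2 s (C * k)})
    (b := fun k => 4 * Real.exp (-1) ^ k)
    ((summable_geometric_of_lt_one (Real.exp_pos _).le
      (Real.exp_lt_one_iff.2 (by norm_num))).mul_left _) ?_
  · filter_upwards [hBC] with p hp
    filter_upwards [hp] with k hk r hr s hs hrs
    refine hk ?_
    simp only [Finset.mem_range, Set.mem_iUnion]
    exact ⟨r, hr, s, hs, hrs⟩
  · filter_upwards [htend.eventually (eventually_pressureSum_le hd)] with k hk
    refine (measure_biUnion_finset_le _ _).trans ?_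
    refine (Finset.sum_le_sum fun r _ => (measure_biUnion_finset_le _ _).trans
      (Finset.sum_le_sum fun s _ => (measure_prod_word_eq_le hP hQ r s _).trans
        (ENNReal.ofReal_le_ofReal hk))).trans ?_
    rw [Finset.sum_const, Finset.sum_const, Finset.card_range, nsmul_eq_mul, nsmul_eq_mul,
      ← ENNReal.ofReal_natCast, ← ENNReal.ofReal_mul (Nat.cast_nonneg _),
      ← ENNReal.ofReal_mul (Nat.cast_nonneg _)]
    refine ENNReal.ofReal_le_ofReal ?_
    push_cast
    have h2 := two_pow_le_exp k
    rw [← Real.exp_nat_mul, pow_succ']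
    calc 2 * (2 : ℝ) ^ k * (2 * 2 ^ k * Real.exp (d * (C * k)))
        = 4 * (2 ^ k * 2 ^ k * Real.exp (d * (C * k))) := by ring
      _ ≤ 4 * (Real.exp (7 / 10 * k) * Real.exp (7 / 10 * k) * Real.exp (d * (C * k))) := by gcongr
      _ ≤ 4 * Real.exp (k * -1) := by
        rw [← Real.exp_add, ← Real.exp_add]
        gcongr 4 * Real.exp ?_
        have : (0 : ℝ) ≤ k := Nat.cast_nonneg k
        nlinarith

end DyadicEvents

/-! ### The upper bound for the parsed words -/

section UpperBound

variable {A : Type*} [Fintype A] [MeasurableSpace A] [MeasurableSingletonClass A]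
variable {P Q : Measure (ℕ → A)} [IsProbabilityMeasure P] [IsProbabilityMeasure Q]

lemma sum_range_two_mul_filter (a : ℕ → ℝ) (H : ℕ → Prop) [DecidablePred H] (c : ℕ) :
    ∑ i ∈ Finset.range (2 * c) with H i, a i =
      ∑ j ∈ Finset.range c with H (2 * j + 0), a (2 * j + 0) +
        ∑ j ∈ Finset.range c with H (2 * j + 1), a (2 * j + 1) := by
  simp only [Finset.sum_filter]
  induction c with
  | zero => simp
  | succ c ih =>
    rw [Nat.mul_succ, Finset.sum_range_succ, Finset.sum_range_succ, ih, Finset.sum_range_succ,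
      Finset.sum_range_succ]
    simp only [Nat.add_zero]
    ring

lemma tendsto_log_two_atTop : Tendsto (Nat.log 2) atTop atTop := by
  refine tendsto_atTop.2 fun b => ?_
  filter_upwards [eventually_ge_atTop (2 ^ b)] with N hN
  exact (Nat.le_log_iff_pow_le (by norm_num) (by have := Nat.one_le_two_pow (n := b); omega)).2 hN

lemma eventually_gap_le {τ : ℕ → ℕ}
    (hτ : (fun n => (τ n : ℝ)) =o[atTop] fun n : ℕ => (n : ℝ)) {C K : ℕ} (hC : 1 ≤ C)
    (hK : 1 ≤ K) : ∀ᶠ k : ℕ in atTop, ∀ n ≤ C * k + 1, τ n ≤ k / K := by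
  have hC0 : (0 : ℝ) < C := by exact_mod_cast hC
  have hK0 : (0 : ℝ) < K := by exact_mod_cast hK
  obtain ⟨B, hB0, hB⟩ := exists_le_mul_add_of_isLittleO hτ (ε := 1 / (2 * C * K)) (by positivity)
  have hlin : ∀ᶠ k : ℕ in atTop, 2 * (1 + B * K) ≤ (k : ℝ) :=
    tendsto_natCast_atTop_atTop.eventually_ge_atTop _
  filter_upwards [hlin] with k hk n hn
  rw [Nat.le_div_iff_mul_le (by omega)]
  have h1 : (n : ℝ) ≤ C * k + 1 := by exact_mod_cast hn
  have h2 : (τ n : ℝ) * K ≤ k := by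
    calc (τ n : ℝ) * K ≤ (1 / (2 * C * K) * n + B) * K := by gcongr; exact hB n
      _ = n / (2 * C) + B * K := by field_simp
      _ ≤ (C * k + 1) / (2 * C) + B * K := by gcongr
      _ = k / 2 + 1 / (2 * C) + B * K := by field_simp
      _ ≤ k / 2 + 1 + B * K := by
        gcongr
        rw [div_le_one (by positivity)]
        have : (1 : ℝ) ≤ C := by exact_mod_cast hC
        linarith
      _ ≤ k := by linarith
  exact_mod_cast h2

/-- The words of the parsing that are followed by a word too short for decoupling are bounded in
number by the positions at which a short improbable word starts. -/
lemma card_filter_parseLength_lt_le {N b : ℕ} {y x : ℕ → A} {g : ℕ → ℕ} {Z : Set ℕ}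
    [DecidablePred (· ∈ Z)]
    (hg : ∀ i, i + 1 < parseCount N y x → g (parseLength N y x i) ≤ b)
    (hZ : ∀ i, i + 1 < parseCount N y x → parseLength N y x i ≤ b → parseEnd N y x i ∈ Z) :
    ((Finset.range (parseCount N y x - 1)).filter (fun i =>
      ¬ g (parseLength N y x i) ≤ parseLength N y x (i + 1))).card ≤
      ((Finset.range N).filter (· ∈ Z)).card + 1 := by
  set c := parseCount N y x with hc
  set J := (Finset.range (c - 1)).filter (fun i =>
      ¬ g (parseLength N y x i) ≤ parseLength N y x (i + 1)) with hJ
  -- The index `c - 2` is set apart since its successor is the last word, which may be short merely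
  -- by truncation. Otherwise the starting point of the successor lies in `Z`, and distinct words
  -- have distinct starting points.
  have h1 : (J.erase (c - 2)).card ≤ ((Finset.range N).filter (· ∈ Z)).card := by
    refine Finset.card_le_card_of_injOn (fun i => parseEnd N y x (i + 1)) ?_ ?_
    · intro i hi
      simp only [hJ, Finset.coe_erase, Finset.coe_filter, Finset.mem_range, Set.mem_sdiff,
        Set.mem_ofPred_eq, Set.mem_singleton_iff, not_le] at hi
      have h2 := hg i (by omega)
      simp only [Finset.coe_filter, Finset.mem_range, Set.mem_ofPred_eq]
      exact ⟨parseEnd_lt (by omega), hZ (i + 1) (by omega) (by omega)⟩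
    · have hlt : ∀ i j, i < j → j + 2 < c → parseEnd N y x (i + 1) < parseEnd N y x (j + 1) := by
        intro i j hij hj
        have h3 : parseEnd N y x (i + 1 + 1) ≤ parseEnd N y x (j + 1) :=
          parseEnd_monotone N y x (by omega)
        have h4 := parseEnd_succ_eq (N := N) (y := y) (x := x) (i := i + 1) (by omega)
        omega
      intro i hi j hj hij
      simp only [hJ, Finset.coe_erase, Finset.coe_filter, Finset.mem_range, Set.mem_sdiff,
        Set.mem_ofPred_eq, Set.mem_singleton_iff, not_le] at hi hj
      simp only at hij
      rcases lt_trichotomy i j with h | h | h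
      · have := hlt i j h (by omega)
        omega
      · exact h
      · have := hlt j i h (by omega)
        omega
  have h2 := Finset.pred_card_le_card_erase (s := J) (a := c - 2)
  omega

theorem ae_eventually_average_parsedWord_le (hP : MeasurePreserving shift P P)
    (hQ : MeasurePreserving shift Q Q) (hsupp : seqSupport Q ⊆ seqSupport P)
    (hSLD : SelectivelyLowerDecoupled P) (hUD : UpperDecoupled Q) (hND : Nondegenerate P Q) {R : ℝ}
    (hR : sInf (pressureSlope P Q '' Set.Ioi 0) < (R : EReal)) :
    ∀ᵐ p : (ℕ → A) × (ℕ → A) ∂(P.prod Q), ∀ᶠ N : ℕ in atTop,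
      1 / (N : ℝ) * ∑ i ∈ Finset.range (parseCount N p.2 p.1 - 1),
        -Real.log (cylProb P (parsedWord N p.2 p.1 i)) ≤ R := by
  obtain ⟨R₀, hR₀, hR₀R⟩ := EReal.lt_iff_exists_real_btwn.1 hR
  replace hR₀R : R₀ < R := by exact_mod_cast hR₀R
  obtain ⟨t, ht, hpt⟩ := exists_pressure_lt_of_sInf_lt hR₀
  have hR₀0 : 0 ≤ R₀ :=
    nonneg_of_mul_nonneg_right (nonneg_of_pressure_lt hP hQ hsupp (le_of_lt ht) hpt) ht
  obtain ⟨τ, hτ, hbound⟩ := hUD.ae_eventually_sum_log_le hQ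
  -- One `ε` for the rate, one for the error term of each parity class, and two for the words
  -- followed by a word that is too short.
  obtain ⟨ε, hε⟩ : ∃ ε, ε = (R - R₀) / 5 := ⟨_, rfl⟩
  have hε0 : 0 < ε := by linarith
  obtain ⟨m, hm⟩ := hbound (fun a => cylProb P a ^ (-t)) (t * R₀) (t * ε) (mul_pos ht hε0)
    ((lintegral_cylProb_rpow_eventually_le hP hQ hsupp hpt).mono fun n hn => hn 0)
  obtain ⟨K₀, hK₀1, hK₀⟩ := hSLD.ae_eventually_occurs hP
  obtain ⟨K₁, hK₁⟩ := exists_nat_ge (16 * R₀)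
  set K := max K₀ K₁ with hK
  have hK1 : 1 ≤ K := hK₀1.trans (le_max_left _ _)
  have hKR : 16 * R₀ ≤ K := hK₁.trans (by exact_mod_cast le_max_right K₀ K₁)
  obtain ⟨C, hC1, hne⟩ := hND.ae_eventually_word_ne hP hQ
  obtain ⟨B, hB0, hB⟩ := ae_eventually_exp_le_cylProb_word hP hQ hsupp ht hpt hC1
  filter_upwards [ae_prod_eventually_occurs hP hQ hsupp hSLD, ae_prod_word_pos hP hQ hsupp,
    Measure.quasiMeasurePreserving_snd.ae hm, hne, Measure.quasiMeasurePreserving_snd.ae hB,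
    Measure.quasiMeasurePreserving_snd.ae
      (ae_eventually_card_improbable_le hP hQ hsupp ht hpt hK1 hKR),
    Measure.quasiMeasurePreserving_fst.ae (hK₀ K (le_max_left _ _))]
    with p hocc hpos hsum hne hB hfew hoccs
  have hk := hne.and (hB.and (hfew.and (hoccs.and ((eventually_gap_le hτ hC1 hK1).and
    ((eventually_ge_atTop 2).and ((eventually_mul_add_le_exp (show 0 < t / 8 by positivity)
      (B / ε) 0).and (eventually_mul_add_le_exp (show (0 : ℝ) < 1 / 2 by norm_num) (B / ε) 0)))))))
  filter_upwards [hocc m, hsum, tendsto_log_two_atTop.eventually hk, eventually_gt_atTop 0]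
    with N hoccN hsumN hkN hN0
  obtain ⟨hne, hB, hfew, hoccs, hgap, hk2, hexp1, hexp2⟩ := hkN
  set k := Nat.log 2 N with hkdef
  have hpowle : 2 ^ k ≤ N := Nat.pow_log_le_self 2 (by omega)
  have hltpow : N < 2 ^ (k + 1) := Nat.lt_pow_succ_log_self (by norm_num) N
  set c := parseCount N p.2 p.1 with hc
  set L := parseEnd N p.2 p.1 with hL
  set n := parseLength N p.2 p.1 with hn
  have hLn : ∀ i, L i + n i = L (i + 1) := parseEnd_add_parseLength N p.2 p.1
  have hLmono : Monotone L := parseEnd_monotone N p.2 p.1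
  have hLle : ∀ i, L i ≤ N := parseEnd_le N p.2 p.1
  have hmn : ∀ i, i + 1 < c → m < n i := fun i hi => lt_parseLength hi hoccN
  -- A longer complete word would contain a match of length `C * k` between the two texts, which
  -- nondegeneracy has excluded.
  have hnC : ∀ i, i + 1 < c → n i ≤ C * k + 1 := by
    intro i hi
    by_contra hcon
    have hCk : k ≤ C * k := Nat.le_mul_of_pos_left k hC1
    obtain ⟨r, hr, hw⟩ := exists_word_eq_of_lt_parseLength (n := C * k) hi (by omega)
      (by change C * k < n i; omega)
    have hLi : L i < N := parseEnd_lt (by omega : i < c)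
    exact hne r (by omega) (L i) (by omega) hw
  set a : ℕ → ℝ := fun i => -Real.log (cylProb P (word p.2 (L i) (n i))) with ha
  have haB : ∀ i, i + 1 < c → a i ≤ B * k := by
    intro i hi
    have hLi : L i < N := parseEnd_lt (by omega : i < c)
    have h1 : Real.exp (-(B * k)) ≤ cylProb P (word p.2 (L i) (n i)) :=
      (hB (L i) (by omega)).trans (cylProb_word_anti P p.2 (L i) (hnC i hi))
    have h2 := (Real.le_log_iff_exp_le (hpos _ _)).2 h1
    simp only [ha]
    linarith
  have hcard : (((Finset.range (c - 1)).filter (fun i => ¬ τ (n i) ≤ n (i + 1))).card : ℝ) ≤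
      2 ^ k * Real.exp (-(t / 8 * k)) + 1 := by
    have h1 := card_filter_parseLength_lt_le (N := N) (b := k / K) (y := p.2) (x := p.1) (g := τ)
      (Z := {s | cylProb P (word p.2 s (k / K)) < Real.exp (-(k / 4))})
      -- If the word of length `k / K` at this start were not improbable, it would occur within the
      -- first `2 ^ k ≤ N` letters of the first text, against the maximality of the match.
      (fun i hi => hgap _ (hnC i hi)) (fun i hi hle => by
        by_contra hcon
        rw [Set.mem_ofPred_eq, not_lt] at hcon
        obtain ⟨r, hr, hw⟩ := hoccs _ (length_word _ _ _) hcon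
        rw [length_word] at hr hw
        exact word_ne_of_parseLength_le hi hle (hr.trans hpowle) hw)
    have h2 : ((Finset.range N).filter
        (fun s => cylProb P (word p.2 s (k / K)) < Real.exp (-(k / 4)))).card ≤
        ((Finset.range (2 ^ (k + 1))).filter
          (fun s => cylProb P (word p.2 s (k / K)) < Real.exp (-(k / 4)))).card :=
      Finset.card_le_card (Finset.filter_subset_filter _
        (Finset.range_subset_range.2 hltpow.le))
    have h3 := h1.trans (Nat.add_le_add_right h2 1)
    have h4 : (((Finset.range (c - 1)).filter (fun i => ¬ τ (n i) ≤ n (i + 1))).card : ℝ) ≤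
        (((Finset.range (2 ^ (k + 1))).filter
          (fun s => cylProb P (word p.2 s (k / K)) < Real.exp (-(k / 4)))).card : ℝ) + 1 := by
      exact_mod_cast h3
    linarith
  set H : ℕ → Prop := fun i => i + 1 < c ∧ τ (n i) ≤ n (i + 1) with hH
  classical
  -- Within one parity class, the skipped word of index `2 * j + r + 1` is the gap after word `2 * j
  -- + r`; `H` guarantees that it is long enough.
  have key : ∀ r, ∑ j ∈ Finset.range c with H (2 * j + r), a (2 * j + r) ≤
      (R₀ + ε) * ∑ j ∈ Finset.range c with H (2 * j + r), (n (2 * j + r) : ℝ) + ε * N := by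
    intro r
    have h := hsumN c ((Finset.range c).filter fun j => H (2 * j + r)) (fun j => L (2 * j + r))
      (fun j => n (2 * j + r)) (fun j _ => hLmono (by omega)) (fun j _ hj => by
        obtain ⟨-, h1, h2⟩ := Finset.mem_filter.1 hj
        have h3 := hLn (2 * j + r)
        have h4 := hLn (2 * j + r + 1)
        have h5 : 2 * (j + 1) + r = 2 * j + r + 1 + 1 := by ring
        have h6 := hLle (2 * j + r + 1)
        simp only [h5]
        exact ⟨hmn _ h1, by omega, by omega, Real.rpow_pos_of_pos (hpos _ _) _⟩)
    have hfilt : (Finset.range c).filter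
        (· ∈ (Finset.range c).filter fun j => H (2 * j + r)) =
        (Finset.range c).filter fun j => H (2 * j + r) := by
      ext i
      simp only [Finset.mem_filter]
      tauto
    rw [hfilt] at h
    have e : ∀ j, Real.log (cylProb P (word p.2 (L (2 * j + r)) (n (2 * j + r))) ^ (-t)) =
        t * a (2 * j + r) := fun j => by
      rw [Real.log_rpow (hpos _ _)]
      simp only [ha]
      ring
    simp only [e] at h
    rw [← Finset.mul_sum] at h
    refine le_of_mul_le_mul_left ?_ ht
    linarith
  have hHeq : (Finset.range (2 * c)).filter H =
      (Finset.range (c - 1)).filter (fun i => τ (n i) ≤ n (i + 1)) := by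
    ext i
    simp only [hH, Finset.mem_filter, Finset.mem_range]
    constructor
    · rintro ⟨h1, h2, h3⟩
      exact ⟨by omega, h3⟩
    · rintro ⟨h1, h3⟩
      exact ⟨by omega, by omega, h3⟩
  have hheavy : ∑ i ∈ Finset.range (c - 1) with τ (n i) ≤ n (i + 1), a i ≤
      (R₀ + ε) * N + 2 * ε * N := by
    have h0 := key 0
    have h1 := key 1
    have h2 : ∑ i ∈ Finset.range (2 * c) with H i, (n i : ℝ) ≤ N := by
      have h3 : ∑ i ∈ Finset.range (2 * c) with H i, n i ≤ N := by
        refine le_trans (Finset.sum_le_sum_of_subset ?_)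
          ((sum_parseLength N p.2 p.1 c).trans_le (hLle c))
        intro i hi
        have := (Finset.mem_filter.1 hi).2.1
        rw [Finset.mem_range]
        omega
      exact_mod_cast h3
    rw [← hHeq, sum_range_two_mul_filter a H c]
    rw [sum_range_two_mul_filter (fun i => (n i : ℝ)) H c] at h2
    have h4 := mul_le_mul_of_nonneg_left h2 (show 0 ≤ R₀ + ε by linarith)
    linarith
  have hlight : ∑ i ∈ Finset.range (c - 1) with ¬ τ (n i) ≤ n (i + 1), a i ≤ 2 * ε * N := by
    have h1 : ∑ i ∈ Finset.range (c - 1) with ¬ τ (n i) ≤ n (i + 1), a i ≤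
        (((Finset.range (c - 1)).filter (fun i => ¬ τ (n i) ≤ n (i + 1))).card : ℝ) * (B * k) := by
      rw [← nsmul_eq_mul]
      refine Finset.sum_le_card_nsmul _ _ _ fun i hi => haB i ?_
      have := Finset.mem_range.1 (Finset.mem_filter.1 hi).1
      omega
    have hBk : 0 ≤ B * k := mul_nonneg hB0 (Nat.cast_nonneg k)
    have h2 : B * k ≤ ε * Real.exp (t / 8 * k) := by
      rw [add_zero, div_mul_eq_mul_div, div_le_iff₀ hε0] at hexp1
      linarith
    have h3 : B * k ≤ ε * 2 ^ k := by
      rw [add_zero, div_mul_eq_mul_div, div_le_iff₀ hε0] at hexp2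
      have h4 := exp_half_le_two_pow k
      rw [show (1 / 2 * (k : ℝ)) = k / 2 by ring] at hexp2
      nlinarith
    -- The exponentially small proportion of exceptional words outweighs the cost `B * k` of each.
    have h4 : (2 : ℝ) ^ k * Real.exp (-(t / 8 * k)) * (B * k) ≤ 2 ^ k * ε := by
      calc (2 : ℝ) ^ k * Real.exp (-(t / 8 * k)) * (B * k)
          ≤ 2 ^ k * Real.exp (-(t / 8 * k)) * (ε * Real.exp (t / 8 * k)) := by gcongr
        _ = 2 ^ k * ε * (Real.exp (-(t / 8 * k)) * Real.exp (t / 8 * k)) := by ring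
        _ = 2 ^ k * ε := by rw [← Real.exp_add, neg_add_cancel, Real.exp_zero, mul_one]
    have h5 : (2 : ℝ) ^ k ≤ N := by exact_mod_cast hpowle
    calc _ ≤ _ := h1
      _ ≤ (2 ^ k * Real.exp (-(t / 8 * k)) + 1) * (B * k) := by gcongr
      _ = 2 ^ k * Real.exp (-(t / 8 * k)) * (B * k) + B * k := by ring
      _ ≤ 2 * ε * 2 ^ k := by linarith
      _ ≤ _ := by gcongr
  have hsplit := Finset.sum_filter_add_sum_filter_not (Finset.range (c - 1))
    (fun i => τ (n i) ≤ n (i + 1)) a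
  have hN0' : (0 : ℝ) < N := by exact_mod_cast hN0
  rw [one_div, inv_mul_le_iff₀ hN0']
  change ∑ i ∈ Finset.range (c - 1), a i ≤ N * R
  have hR' : R = R₀ + 5 * ε := by rw [hε]; ring
  rw [← hsplit, hR']
  linarith

end UpperBound

end ZivMerhav

/-! ### Conclusion -/

theorem proposition3p5 {A : Type*} [Fintype A] [MeasurableSpace A] [MeasurableSingletonClass A]
    (P Q : Measure (ℕ → A)) [IsProbabilityMeasure P] [IsProbabilityMeasure Q]
    (hP : MeasurePreserving ZivMerhav.shift P P) (hQ : MeasurePreserving ZivMerhav.shift Q Q)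
    (hsupp : ZivMerhav.seqSupport Q ⊆ ZivMerhav.seqSupport P)
    (hSLD : ZivMerhav.SelectivelyLowerDecoupled P) (hSE : ZivMerhav.DecaysSlowlyEnough P)
    (hUD : ZivMerhav.UpperDecoupled Q) (hND : ZivMerhav.Nondegenerate P Q) :
    ∃ Dminus Dplus : EReal,
      ZivMerhav.HasLeftDeriv (ZivMerhav.pressure P Q) 0 Dminus ∧
      ZivMerhav.HasRightDeriv (ZivMerhav.pressure P Q) 0 Dplus ∧
      ∀ᵐ p : (ℕ → A) × (ℕ → A) ∂(P.prod Q),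
        Dminus ≤ liminf (fun N : ℕ =>
          ((1 / ((N : ℝ) - (ZivMerhav.parseCount N p.2 p.1 : ℝ)) *
            ∑ i ∈ Finset.range (ZivMerhav.parseCount N p.2 p.1),
              -Real.log (ZivMerhav.cylProb P (ZivMerhav.trimmedWord N p.2 p.1 i)) : ℝ) : EReal))
          atTop ∧
        limsup (fun N : ℕ =>
          ((1 / (N : ℝ) *
            ∑ i ∈ Finset.range (ZivMerhav.parseCount N p.2 p.1 - 1),
              -Real.log (ZivMerhav.cylProb P (ZivMerhav.parsedWord N p.2 p.1 i)) : ℝ) : EReal))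
          atTop ≤ Dplus := by
  refine ⟨_, _, ZivMerhav.hasLeftDeriv_pressure hP hQ hsupp,
    ZivMerhav.hasRightDeriv_pressure hP hQ hsupp, ?_⟩
  set Dminus := sSup (ZivMerhav.pressureSlope P Q '' Set.Iio 0)
  set Dplus := sInf (ZivMerhav.pressureSlope P Q '' Set.Ioi 0)
  -- The exceptional null set depends on the threshold, so thresholds are restricted to the
  -- countable set of rationals.
  have hlower : ∀ᵐ p : (ℕ → A) × (ℕ → A) ∂(P.prod Q), ∀ q : ℚ, ((q : ℝ) : EReal) < Dminus →
      ∀ᶠ N : ℕ in atTop, (q : ℝ) ≤ 1 / ((N : ℝ) - (ZivMerhav.parseCount N p.2 p.1 : ℝ)) *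
        ∑ i ∈ Finset.range (ZivMerhav.parseCount N p.2 p.1),
          -Real.log (ZivMerhav.cylProb P (ZivMerhav.trimmedWord N p.2 p.1 i)) :=
    ae_all_iff.2 fun q => by
      by_cases h : ((q : ℝ) : EReal) < Dminus
      · filter_upwards [ZivMerhav.ae_eventually_le_average_trimmedWord hP hQ hsupp hSLD hUD h]
          with p hp _ using hp
      · exact Eventually.of_forall fun _ h' => absurd h' h
  have hupper : ∀ᵐ p : (ℕ → A) × (ℕ → A) ∂(P.prod Q), ∀ q : ℚ, Dplus < ((q : ℝ) : EReal) →
      ∀ᶠ N : ℕ in atTop, 1 / (N : ℝ) * ∑ i ∈ Finset.range (ZivMerhav.parseCount N p.2 p.1 - 1),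
        -Real.log (ZivMerhav.cylProb P (ZivMerhav.parsedWord N p.2 p.1 i)) ≤ (q : ℝ) :=
    ae_all_iff.2 fun q => by
      by_cases h : Dplus < ((q : ℝ) : EReal)
      · filter_upwards [ZivMerhav.ae_eventually_average_parsedWord_le hP hQ hsupp hSLD hUD hND h]
          with p hp _ using hp
      · exact Eventually.of_forall fun _ h' => absurd h' h
  filter_upwards [hlower, hupper] with p hp hp'
  constructor
  · refine le_of_forall_lt fun d hd => ?_
    obtain ⟨q, hdq, hq⟩ := EReal.lt_iff_exists_rat_btwn.1 hd
    exact hdq.trans_le (le_liminf_of_le (by isBoundedDefault)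
      ((hp q hq).mono fun N hN => EReal.coe_le_coe_iff.2 hN))
  · refine le_of_forall_gt fun d hd => ?_
    obtain ⟨q, hq, hdq⟩ := EReal.lt_iff_exists_rat_btwn.1 hd
    exact (limsup_le_of_le (by isBoundedDefault)
      ((hp' q hq).mono fun N hN => EReal.coe_le_coe_iff.2 hN)).trans_lt hdq
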